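/- Let $d\ge 1$ and $R\ge 1$ be integers, and let $|\cdot|$ be the sup norm on $\mathbb Z^d$. Let $\mu$ be a probability distribution on $\{0,1,2,\dots\}$ that is not a point mass, let $\xi\sim\mu$, and suppose that $\mathbb E[\xi^{1+\beta}]<\infty$ for some real $\beta>d+1$. Put $$\hat\mu(k)=\frac{\mathbb P(\xi\ge k)}{\mathbb E[\xi]+1}\quad(k\ge 0),\qquad \gamma_\mu=\inf_{k:\,\hat\mu(k)>0}\frac{\mu(k)}{\hat\mu(k)},$$ and suppose that $\gamma_\mu>0$. **The environment.** Consider three independent i.i.d. collections $(\hat W^x_t)$, $(Z^x_t)$, $(Y^x_t)$, indexed by $(x,t)\in\mathbb Z^d\times\mathbb Z$: the $\hat W^x_t$ have law $\hat\mu$, the $Z^x_t$ are Bernoulli with parameter $\gamma_\mu$, and the $Y^x_t$ have a law $\nu$ on $\{0,1,2,\dots\}$ with $(1-\gamma_\mu)\nu=\mu-\gamma_\mu\hat\mu$ (if $\gamma_\mu=1$, then $\mu=\hat\mu$ and $\nu$ is an arbitrary fixed law). Put $W^x_t=Z^x_t\hat W^x_t+(1-Z^x_t)Y^x_t$. For $K\in\mathbb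 N$ let $X^{(K)}_{-K}(x)=0$ and, for $t\ge -K$, let $X^{(K)}_{t+1}(x)=X^{(K)}_t(x)-1$ if $X^{(K)}_t(x)\ge 1$ and $X^{(K)}_{t+1}(x)=W^x_{t+1}$ if $X^{(K)}_t(x)=0$. Let $\omega(x,t)=\lim_{K\to\infty}X^{(K)}_t(x)$ (the limit exists almost surely, and the processes $\omega(x,\cdot)$ are independent stationary renewal chains with interarrival law $\mu$). **The field $\eta$.** Let $t^0=0$ and $t^x=-\lceil |x|/R\rceil+1$ for $x\in\mathbb Z^d\setminus\{0\}$. For $(x_0,t_0)\in\mathbb Z^d\times\mathbb Z$ and $x\in\mathbb Z^d$ let $$T^x(x_0,t_0)=\inf\{t\ge t_0+t^{x-x_0}:\ \omega(x,t)=0\text{ and }Z^x_{t+1}=1\}\qquad(\inf\emptyset=+\infty),$$ and let $\eta(x_0,t_0)\in\{0,1\}$ be the indicator of the event that $T^x(x_0,t_0)<t_0+|x-x_0|/R$ for all $x\ne x_0$ and $T^{x_0}(x_0,t_0)=t_0$. **Boxes.** A box is a set $A=\prod_{i=1}^{d+1}([a_i,b_i]\cap\mathbb Z)$ with integers $a_i\le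 b_i$. Put $r(A)=\max_{i\le d}(b_i-a_i)$ and $h(A)=b_{d+1}-a_{d+1}$. For boxes $A$ and $A'=\prod_{i=1}^{d+1}([a'_i,b'_i]\cap\mathbb Z)$, let $\mathrm{sep}(A,A')$ be $a_{d+1}-b'_{d+1}$ if $b'_{d+1}<a_{d+1}$, be $a'_{d+1}-b_{d+1}$ if $b_{d+1}<a'_{d+1}$, and be $0$ otherwise. **Claim.** There is a constant $c>0$, which depends only on $d$, $R$, $\mu$, $\beta$ (and on $\nu$ if $\gamma_\mu=1$), such that $$\varepsilon(r,h,s)=c\,(r+s)^d\,h\,s^{d-\beta+1}$$ is a decoupling function for $\eta$, that is: for all integers $r\ge 0$, $h\ge 1$, $s\ge 1$, all boxes $A,B\subseteq\mathbb Z^{d+1}$ with $\max(r(A),r(B))\le r$, $\max(h(A),h(B))\le h$ and $\mathrm{sep}(A,B)\ge s$, and all $f_1:\{0,1\}^A\to\{0,1\}$ and $f_2:\{0,1\}^B\to\{0,1\}$, $$\mathbb E[f_1(\eta_A)f_2(\eta_B)]\le\mathbb E[f_1(\eta_A)]\,\mathbb E[f_2(\eta_B)]+\varepsilon(r,h,s).$$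 -/

import Mathlib

universe u

open MeasureTheory ProbabilityTheory Filter
open scoped ENNReal

noncomputable section

namespace RenewalField

/-- Space-time points `z = (x, t)` with `x ∈ ℤ^d` and `t ∈ ℤ`. The norm on `Fin d → ℤ` is the
sup norm, and the order on `Site d` is the coordinatewise one. -/
abbrev Site (d : ℕ) : Type := (Fin d → ℤ) × ℤ

/-! ### Boxes and decoupling functions -/

/-- A box `∏ ⟦a_i, b_i⟧` of `ℤ^d × ℤ` with `a_i ≤ b_i` for all `i`. -/
structure Box (d : ℕ) where
  lo : Site d
  hi : Site d
  le : lo ≤ hi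

namespace Box

variable {d : ℕ}

/-- The points of the box. -/
def sites (A : Box d) : Set (Site d) := Set.Icc A.lo A.hi

/-- The spatial diameter, the maximum of `b_i - a_i` over the `d` spatial coordinates. -/
def spatialDiam (A : Box d) : ℕ := Finset.univ.sup fun i => (A.hi.1 i - A.lo.1 i).toNat

/-- The height, which is the length of the time interval. -/
def height (A : Box d) : ℕ := (A.hi.2 - A.lo.2).toNat

/-- The vertical separation of two boxes. -/
def sep (A B : Box d) : ℤ :=
  if B.hi.2 < A.lo.2 then A.lo.2 - B.hi.2
  else if A.hi.2 < B.lo.2 then B.lo.2 - A.hi.2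
  else 0

end Box

/-- `ε` is a decoupling function for the random field `η` with values in `{0, 1}`:
for all boxes `A`, `B` with diameters at most `r`, heights at most `h` and vertical separation at
least `s`, and all `f₁ : {0,1}^A → {0,1}`, `f₂ : {0,1}^B → {0,1}`,
`E[f₁(η_A) f₂(η_B)] ≤ E[f₁(η_A)] E[f₂(η_B)] + ε(r, h, s)`. Here `r ≥ 0`, `h ≥ 1`, `s ≥ 1`. -/
def IsDecouplingFunction {d : ℕ} {Ω : Type*} [MeasurableSpace Ω] (P : Measure Ω)
    (η : Site d → Ω → Fin 2) (ε : ℝ → ℝ → ℝ → ℝ) : Prop :=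
  ∀ r h s : ℕ, 1 ≤ h → 1 ≤ s →
    ∀ A B : Box d,
      max A.spatialDiam B.spatialDiam ≤ r → max A.height B.height ≤ h → (s : ℤ) ≤ A.sep B →
      ∀ (f₁ : (A.sites → Fin 2) → Fin 2) (f₂ : (B.sites → Fin 2) → Fin 2),
        ∫ o, ((f₁ fun z => η z o).val : ℝ) * ((f₂ fun z => η z o).val : ℝ) ∂P ≤
          (∫ o, ((f₁ fun z => η z o).val : ℝ) ∂P) * (∫ o, ((f₂ fun z => η z o).val : ℝ) ∂P)
            + ε r h s

/-! ### The interarrival law and the driving variables -/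

/-- The mean `E[ξ]` of `ξ ∼ μ`. -/
def mean (μ : PMF ℕ) : ℝ≥0∞ := ∑' n : ℕ, (n : ℝ≥0∞) * μ n

/-- The moment `E[ξ ^ p]` of `ξ ∼ μ`. -/
def moment (μ : PMF ℕ) (p : ℝ) : ℝ≥0∞ := ∑' n : ℕ, (n : ℝ≥0∞) ^ p * μ n

/-- The mass function `P(ξ ≥ k) / (E[ξ] + 1)` of the stationary law of the renewal chain. -/
def stationaryMass (μ : PMF ℕ) (k : ℕ) : ℝ≥0∞ :=
  (∑' n : ℕ, if k ≤ n then μ n else 0) / (mean μ + 1)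

/-- The infimum of `μ(k) / μ̂(k)` over the `k` with `μ̂(k) > 0`, where `μ̂` is the stationary law. -/
def gammaConst (μ : PMF ℕ) : ℝ≥0∞ :=
  ⨅ (k : ℕ) (_ : 0 < stationaryMass μ k), μ k / stationaryMass μ k

/-- `ν` is a law for the variables `Y`: `(1 - γ) ν = μ - γ μ̂`. It determines `ν` when `γ < 1`;
when `γ = 1` (that is, `μ = μ̂`) every `ν` is admitted, since then the variables `Y` are not used. -/
def IsResidualLaw (μ ν : PMF ℕ) : Prop :=
  ∀ k, gammaConst μ * stationaryMass μ k + (1 - gammaConst μ) * ν k = μ k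

/-- The three independent i.i.d. collections that drive the environment: `V` with the stationary
law `μ̂`, `Z` with the Bernoulli law of parameter `γ`, and `Y` with law `ν`. -/
structure IsDriving {d : ℕ} {Ω : Type*} [MeasurableSpace Ω] (P : Measure Ω) (μ ν : PMF ℕ)
    (V Z Y : Site d → Ω → ℕ) : Prop where
  measurable_V : ∀ z, Measurable (V z)
  measurable_Z : ∀ z, Measurable (Z z)
  measurable_Y : ∀ z, Measurable (Y z)
  law_V : ∀ z k, P (V z ⁻¹' {k}) = stationaryMass μ k
  law_Z_one : ∀ z, P (Z z ⁻¹' {1}) = gammaConst μ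
  law_Z_zero : ∀ z, P (Z z ⁻¹' {0}) = 1 - gammaConst μ
  law_Y : ∀ z k, P (Y z ⁻¹' {k}) = ν k
  indep : iIndepFun (Sum.elim V (Sum.elim Z Y)) P

/-! ### The environment and the field -/

/-- The jumps `W = Z V + (1 - Z) Y`. -/
def jumps {d : ℕ} (V Z Y : Site d → ℕ) (z : Site d) : ℕ := Z z * V z + (1 - Z z) * Y z

/-- `chainFrom W K n` is the state at time `-K + n` of the renewal chain that is started from `0`
at time `-K` and takes its jumps from `W`. -/
def chainFrom (W : ℤ → ℕ) (K : ℕ) : ℕ → ℕ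
  | 0 => 0
  | n + 1 => if chainFrom W K n = 0 then W (-(K : ℤ) + n + 1) else chainFrom W K n - 1

/-- The environment `ω(x, t)`, the limit as `K → ∞` of the state at time `t` of the chain at `x`
started from `0` at time `-K`. -/
def environment {d : ℕ} (W : Site d → ℕ) (z : Site d) : ℕ :=
  limUnder atTop fun K : ℕ => chainFrom (fun t => W (z.1, t)) K (z.2 + K).toNat

/-- The height above `x` at which the search for a renewal starts, for the cone rooted at `0`:
the outer boundary of the past cone for `x ≠ 0`, and `0` at the tip. -/
def startTime {d : ℕ} (R : ℕ) (x : Fin d → ℤ) : ℤ := if x = 0 then 0 else -⌈‖x‖ / R⌉ + 1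

/-- The time `T^x(x₀, t₀)`, the infimum of the times `t ≥ t₀ + startTime (x - x₀)` with
`ω(x, t) = 0` and `Z(x, t + 1) = 1`; it is `+∞` if there are none. -/
def hitTime {d : ℕ} (R : ℕ) (ω Z : Site d → ℕ) (x : Fin d → ℤ) (z₀ : Site d) : EReal :=
  sInf ((fun t : ℤ => ((t : ℝ) : EReal)) ''
    {t : ℤ | z₀.2 + startTime R (x - z₀.1) ≤ t ∧ ω (x, t) = 0 ∧ Z (x, t + 1) = 1})

open Classical in
/-- `η(x₀, t₀)`, the indicator of the event that `T^x < t₀ + |x - x₀| / R` for all `x ≠ x₀` and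
`T^{x₀} = t₀`. -/
def etaOf {d : ℕ} (R : ℕ) (ω Z : Site d → ℕ) (z₀ : Site d) : Fin 2 :=
  if (∀ x : Fin d → ℤ, x ≠ z₀.1 →
        hitTime R ω Z x z₀ < (((z₀.2 : ℝ) + ‖x - z₀.1‖ / R : ℝ) : EReal)) ∧
      hitTime R ω Z z₀.1 z₀ = ((z₀.2 : ℝ) : EReal)
  then 1 else 0

/-- The random field `η` built from the driving variables. -/
def eta {d : ℕ} {Ω : Type*} (R : ℕ) (V Z Y : Site d → Ω → ℕ) (z : Site d) (o : Ω) : Fin 2 :=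
  etaOf R (environment (jumps (fun w => V w o) (fun w => Z w o) (fun w => Y w o)))
    (fun w => Z w o) z

end RenewalField

end

namespace RenewalField

open Topology

/-! ### Coalescence of the chains at cut times -/

section Deterministic

/-! The field `η` is a cone functional of a Bernoulli field. Call `(x, t)` marked if `ω(x, t) = 0`
and `Z(x, t + 1) = 1`. At a marked point the next state is the fresh variable `V(x, t + 1)`, whose
law is the stationary law and which is independent of the mark and of the past. Hence conditioning
on marked points leaves the law of the current state stationary, and the marked points of a column
are independent with density `p = γ μ̂(0) > 0` (`measure_biInter_markedRenewal_inter`). Distinct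
columns use disjoint driving variables, so all marked events are independent
(`iIndepSet_renewalEvent`).

The environment is a genuine limit because almost surely there are arbitrarily early times which no
jump passes over (`ae_hasCutTimes`); the recursion for the law then identifies the stationary law
(`measure_limitChain_eq`).

Finally `η(z) = 1` means that `z` is marked and that every window of the double cone at `z` contains
a marked point (`eta_eq_one_iff`). A window of radius `m` is empty with probability `(1 - p) ^ (2m -
1)`, so ignoring the windows of radius above `l` costs an error exponentially small in `l`
(`measure_farEvent_le`). With `l` about `s / 2` the truncated fields on the two boxes live on
disjoint time slabs and are independent (`coneField_decoupling`). Geometric decay beats any power of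
`s`; the moment hypothesis serves only to make the mean finite. -/

theorem chainFrom_le {W : ℤ → ℕ} {u : ℤ} (hu : ∀ j : ℕ, W (u - j) ≤ j) (K : ℕ) :
    ∀ n : ℕ, -(K : ℤ) + n ≤ u → (chainFrom W K n : ℤ) ≤ u - (-(K : ℤ) + n)
  | 0, h => by simp only [chainFrom]; push_cast at h ⊢; omega
  | n + 1, h => by
    have ih := chainFrom_le hu K n (by push_cast at h; omega)
    simp only [chainFrom]
    push_cast at h ⊢
    -- The bound is the time left until `u`. A new jump respects it by `hu`; otherwise both sides
    -- decrease by one.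
    split_ifs with h0
    · have := hu (u - (-(K : ℤ) + n + 1)).toNat
      rw [Int.toNat_of_nonneg (by omega), sub_sub_cancel] at this
      omega
    · omega

/-- If no jump passes over the time `u`, then every chain started before `u` renews at `u`. -/
theorem chainFrom_eq_zero {W : ℤ → ℕ} {u : ℤ} (hu : ∀ j : ℕ, W (u - j) ≤ j) {K n : ℕ}
    (h : -(K : ℤ) + n = u) : chainFrom W K n = 0 := by
  have := chainFrom_le hu K n h.le
  omega

/-- Chains that use the same jumps coalesce: once they agree at a common time, they agree forever.
-/
theorem chainFrom_add_congr (W : ℤ → ℕ) {K n K' n' : ℕ} (h : -(K : ℤ) + n = -(K' : ℤ) + n')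
    (h0 : chainFrom W K n = chainFrom W K' n') (m : ℕ) :
    chainFrom W K (n + m) = chainFrom W K' (n' + m) := by
  induction m with
  | zero => exact h0
  | succ m ih =>
    rw [← add_assoc, ← add_assoc, chainFrom, chainFrom, ih,
      show -(K : ℤ) + (n + m : ℕ) + 1 = -(K' : ℤ) + (n' + m : ℕ) + 1 by push_cast; omega]

/-- The limit chain on `ℤ` with jumps `W`. -/
noncomputable def limitChain (W : ℤ → ℕ) (t : ℤ) : ℕ :=
  limUnder atTop fun K : ℕ => chainFrom W K (t + K).toNat

/-- There are arbitrarily early times over which no jump passes. -/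
def HasCutTimes (W : ℤ → ℕ) : Prop := ∀ n : ℤ, ∃ u ≤ n, ∀ j : ℕ, W (u - j) ≤ j

/-- All chains started before a cut time `u ≤ t` vanish at `u` and then coincide, so the sequence in
`K` is eventually constant. Thus `limUnder` is an actual limit here and not a default value. -/
theorem HasCutTimes.eventually_eq {W : ℤ → ℕ} (h : HasCutTimes W) (t : ℤ) :
    ∀ᶠ K : ℕ in atTop, chainFrom W K (t + K).toNat = limitChain W t := by
  obtain ⟨u, hut, hu⟩ := h t
  obtain ⟨K₀, hK₀⟩ : ∃ K₀ : ℕ, -(K₀ : ℤ) ≤ u := ⟨(-u).toNat, by omega⟩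
  have key : ∀ K ≥ K₀, chainFrom W K (t + K).toNat = chainFrom W K₀ (t + K₀).toNat := by
    intro K hK
    have e := chainFrom_add_congr W (K := K) (K' := K₀) (n := (u + K).toNat)
      (n' := (u + K₀).toNat) (by omega)
      ((chainFrom_eq_zero hu (by omega)).trans (chainFrom_eq_zero hu (by omega)).symm)
      (t - u).toNat
    convert e using 2 <;> omega
  have hlim : Tendsto (fun K : ℕ => chainFrom W K (t + K).toNat) atTop
      (𝓝 (chainFrom W K₀ (t + K₀).toNat)) :=
    tendsto_const_nhds.congr' ((eventually_ge_atTop K₀).mono fun K hK => (key K hK).symm)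
  rw [limitChain, hlim.limUnder_eq]
  exact (eventually_ge_atTop K₀).mono key

theorem HasCutTimes.limitChain_succ {W : ℤ → ℕ} (h : HasCutTimes W) (t : ℤ) :
    limitChain W (t + 1) = if limitChain W t = 0 then W (t + 1) else limitChain W t - 1 := by
  obtain ⟨K, h1, h2, h3⟩ := ((h.eventually_eq t).and ((h.eventually_eq (t + 1)).and
    (eventually_ge_atTop (-t).toNat))).exists
  rw [← h1, ← h2, show (t + 1 + K).toNat = (t + K).toNat + 1 by omega, chainFrom]
  congr 2
  omega

end Deterministic

/-! ### The filtration of one column -/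

section OneSite

variable {Ω : Type*} {mΩ : MeasurableSpace Ω} {P : Measure Ω}

/-- The information up to time `n`. -/
abbrev past (F : ℤ → MeasurableSpace Ω) (n : ℤ) : MeasurableSpace Ω := ⨆ v ∈ Set.Iic n, F v

theorem le_past (F : ℤ → MeasurableSpace Ω) {v n : ℤ} (h : v ≤ n) : F v ≤ past F n :=
  le_iSup₂_of_le v h le_rfl

theorem past_mono (F : ℤ → MeasurableSpace Ω) : Monotone (past F) :=
  fun _ _ h => iSup₂_le fun _ hv => le_past F (le_trans hv h)

theorem past_le {F : ℤ → MeasurableSpace Ω} (hF : ∀ v, F v ≤ mΩ) (n : ℤ) : past F n ≤ mΩ :=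
  iSup₂_le fun v _ => hF v

theorem indep_past {F : ℤ → MeasurableSpace Ω} (hF : ∀ v, F v ≤ mΩ) (hi : iIndep F P)
    {n m : ℤ} (h : n < m) : Indep (past F n) (F m) P := by
  have := indep_iSup_of_disjoint hF hi (S := Set.Iic n) (T := {m})
    (Set.disjoint_singleton_right.2 (by simpa using h))
  simpa [past] using this

variable {F : ℤ → MeasurableSpace Ω} {W : ℤ → Ω → ℕ}

theorem measurable_chainFrom (hW : ∀ v, Measurable[F v] (W v)) (K n : ℕ) :
    Measurable[past F (-(K : ℤ) + n)] fun o => chainFrom (fun v => W v o) K n := by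
  induction n with
  | zero => exact @measurable_const _ _ _ (_) _
  | succ n ih =>
    have h1 := ih.mono (past_mono F (show -(K : ℤ) + n ≤ -(K : ℤ) + (n + 1 : ℕ) by simp)) le_rfl
    have h2 := (hW (-(K : ℤ) + n + 1)).mono
      (le_past F (show -(K : ℤ) + n + 1 ≤ -(K : ℤ) + (n + 1 : ℕ) by push_cast; omega)) le_rfl
    simp only [chainFrom]
    refine Measurable.ite ?_ h2 (Measurable.sub_const h1 1)
    exact h1 (measurableSet_singleton 0)

theorem measurable_limitChain (hW : ∀ v, Measurable[F v] (W v)) (t : ℤ) :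
    Measurable[past F t] fun o => limitChain (fun v => W v o) t := by
  have key : ∀ K : ℕ, (K : ℤ) ≥ -t →
      Measurable[past F t] fun o => chainFrom (fun v => W v o) K (t + K).toNat := by
    intro K hK
    have := measurable_chainFrom hW K (t + K).toNat
    rwa [show -(K : ℤ) + (t + K).toNat = t by omega] at this
  -- For `K < -t` the chain starts after time `t` and `toNat` truncates to `0`. Shifting the index
  -- discards these terms without changing the limit.
  have e : (fun o => limitChain (fun v => W v o) t) = fun o => limUnder atTop fun K : ℕ =>
      chainFrom (fun v => W v o) (K + (-t).toNat) (t + (K + (-t).toNat : ℕ)).toNat := by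
    funext o
    simp only [limitChain, limUnder]
    congr 1
    conv_lhs => rw [← Filter.map_add_atTop_eq_nat (-t).toNat, Filter.map_map]
    rfl
  rw [e]
  exact (@StronglyMeasurable.limUnder _ _ _ (past F t) _ _ _ _ _ _ _ fun K =>
    (key (K + (-t).toNat) (by push_cast; omega)).stronglyMeasurable).measurable

/-- One step of the chain, on an event of the past. -/
theorem measure_inter_step [IsProbabilityMeasure P] (hF : ∀ v, F v ≤ mΩ) (hi : iIndep F P)
    (hW : ∀ v, Measurable[F v] (W v)) {μ : ℕ → ℝ≥0∞} (hlaw : ∀ v k, P (W v ⁻¹' {k}) = μ k)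
    {n : ℤ} {X X' : Ω → ℕ} (hX : Measurable[past F n] X)
    (hX' : ∀ᵐ o ∂P, X' o = if X o = 0 then W (n + 1) o else X o - 1)
    {A : Set Ω} (hA : MeasurableSet[past F n] A) (k : ℕ) :
    P (A ∩ X' ⁻¹' {k}) = P (A ∩ X ⁻¹' {k + 1}) + P (A ∩ X ⁻¹' {0}) * μ k := by
  have hle := past_le hF n
  have h0 : MeasurableSet[past F n] (A ∩ X ⁻¹' {0}) :=
    MeasurableSet.inter hA (hX (measurableSet_singleton 0))
  have hind := (Indep_iff _ _ P).1 (indep_past hF hi (lt_add_one n)) _ _ h0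
    (hW (n + 1) (measurableSet_singleton k))
  rw [hlaw] at hind
  -- The state `k` is reached either by descent from `k + 1` or by a renewal followed by a jump `k`,
  -- and that jump is independent of the past.
  rw [← hind, ← measure_union]
  · refine measure_congr ?_
    filter_upwards [hX'] with o ho
    refine propext ?_
    change (o ∈ A ∧ X' o = k) ↔ (o ∈ A ∧ X o = k + 1) ∨ ((o ∈ A ∧ X o = 0) ∧ W (n + 1) o = k)
    rw [ho]
    split_ifs with h
    · simp [h]
    · constructor
      · rintro ⟨h1, h2⟩; exact Or.inl ⟨h1, by omega⟩
      · rintro (⟨h1, h2⟩ | ⟨⟨_, h2⟩, _⟩)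
        · exact ⟨h1, by omega⟩
        · exact absurd h2 h
  · rw [Set.disjoint_left]
    rintro o ⟨_, h1⟩ ⟨⟨_, h2⟩, _⟩
    simp only [Set.mem_preimage, Set.mem_singleton_iff] at h1 h2
    omega
  · exact (hle _ h0).inter (hF _ _ (hW (n + 1) (measurableSet_singleton k)))

end OneSite

end RenewalField

/-! ### Existence of cut times and the stationary law -/

namespace RenewalField

open Topology

/-- The tail `P(ξ ≥ k)` of the mass function `μ`. -/
noncomputable def tail (μ : ℕ → ℝ≥0∞) (k : ℕ) : ℝ≥0∞ := ∑' n : ℕ, if k ≤ n then μ n else 0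

section

variable {Ω : Type*} {mΩ : MeasurableSpace Ω} {P : Measure Ω}

theorem measure_preimage_eq_tsum {X : Ω → ℕ} (hX : Measurable X) (S : Set ℕ)
    [DecidablePred (· ∈ S)] :
    P (X ⁻¹' S) = ∑' n, if n ∈ S then P (X ⁻¹' {n}) else 0 := by
  have h := Measure.tsum_indicator_apply_singleton (P.map X) S (MeasurableSet.of_discrete)
  rw [Measure.map_apply hX MeasurableSet.of_discrete] at h
  rw [← h]
  refine tsum_congr fun n => ?_
  rw [Set.indicator_apply, Measure.map_apply hX MeasurableSet.of_discrete]

theorem tsum_measure_preimage_singleton [IsProbabilityMeasure P] {X : Ω → ℕ}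
    (hX : Measurable X) : ∑' n, P (X ⁻¹' {n}) = 1 := by
  simpa using (measure_preimage_eq_tsum (P := P) hX Set.univ).symm

variable {F : ℤ → MeasurableSpace Ω} {W : ℤ → Ω → ℕ} {μ : ℕ → ℝ≥0∞}

/-- Ask that the last `J` jumps up to `u` vanish, which has probability `μ 0 ^ J`. By a union bound
some earlier jump passes over `u` with probability at most the remainder of the convergent series of
tails, which is below `1` for large `J`. The two requirements are independent. -/
theorem exists_le_measure_cut [IsProbabilityMeasure P] (hF : ∀ v, F v ≤ mΩ) (hi : iIndep F P)
    (hW : ∀ v, Measurable[F v] (W v)) (hlaw : ∀ v k, P (W v ⁻¹' {k}) = μ k)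
    (h0 : μ 0 ≠ 0) (hsum : ∑' k, tail μ k ≠ ⊤) :
    ∃ δ : ℝ≥0∞, 0 < δ ∧ ∀ u : ℤ, δ ≤ P {o | ∀ j : ℕ, W (u - j) o ≤ j} := by
  obtain ⟨J, hJ⟩ : ∃ J : ℕ, ∑' k, tail μ (k + J) < 1 :=
    ((tendsto_order.1 (ENNReal.tendsto_sum_nat_add _ hsum)).2 1 one_pos).exists
  refine ⟨μ 0 ^ J * (1 - ∑' k, tail μ (k + J)), ?_, fun u => ?_⟩
  · exact ENNReal.mul_pos (pow_ne_zero _ h0) (tsub_pos_of_lt hJ).ne'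
  have hsub : (⋂ v ∈ Finset.Ioc (u - J) u, W v ⁻¹' {0}) ∩ (⋂ j : ℕ, W (u - J - j) ⁻¹' Set.Iic (j + J))
      ⊆ {o | ∀ j : ℕ, W (u - j) o ≤ j} := by
    rintro o ⟨h1, h2⟩ j
    simp only [Set.mem_iInter, Set.mem_preimage, Set.mem_singleton_iff, Set.mem_Iic,
      Finset.mem_Ioc] at h1 h2
    rcases lt_or_ge j J with h | h
    · rw [h1 (u - j) ⟨by omega, by omega⟩]; exact Nat.zero_le _
    · have := h2 (j - J)
      rwa [Nat.sub_add_cancel h, show u - J - ((j - J : ℕ) : ℤ) = u - j by omega] at this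
  refine le_trans ?_ (measure_mono hsub)
  have hind : Indep (⨆ v ∈ Set.Ioi (u - J), F v) (⨆ v ∈ Set.Iic (u - J), F v) P :=
    indep_iSup_of_disjoint hF hi (Set.disjoint_left.2 fun v h1 h2 =>
      absurd (Set.mem_Ioi.1 h1) (not_lt_of_ge (Set.mem_Iic.1 h2)))
  rw [(Indep_iff _ _ P).1 hind]
  · refine mul_le_mul' ?_ ?_
    · rw [hi.meas_biInter fun v _ => hW v (measurableSet_singleton 0)]
      simp [hlaw]
    · rw [tsub_le_iff_right]
      have hm : MeasurableSet (⋂ j : ℕ, W (u - J - j) ⁻¹' Set.Iic (j + J)) :=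
        MeasurableSet.iInter fun j => hF _ _ (hW _ measurableSet_Iic)
      have hc : P (⋂ j : ℕ, W (u - J - j) ⁻¹' Set.Iic (j + J))ᶜ ≤ ∑' k, tail μ (k + J) := by
        rw [Set.compl_iInter]
        refine (measure_iUnion_le _).trans (ENNReal.tsum_le_tsum fun j => ?_)
        have : (W (u - J - j) ⁻¹' Set.Iic (j + J))ᶜ ⊆ W (u - J - j) ⁻¹' Set.Ici (j + J) := by
          intro o ho
          simp only [Set.mem_compl_iff, Set.mem_preimage, Set.mem_Iic, Set.mem_Ici] at ho ⊢
          omega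
        refine (measure_mono this).trans_eq ?_
        classical
        rw [measure_preimage_eq_tsum ((hW _).mono (hF _) le_rfl)]
        simp only [hlaw, tail, Set.mem_Ici]
      calc (1 : ℝ≥0∞) = P (⋂ j : ℕ, W (u - J - j) ⁻¹' Set.Iic (j + J))
            + P (⋂ j : ℕ, W (u - J - j) ⁻¹' Set.Iic (j + J))ᶜ := by
            rw [measure_add_measure_compl hm, measure_univ]
        _ ≤ _ := by gcongr
  · refine Finset.measurableSet_biInter _ fun v hv => ?_
    exact le_iSup₂_of_le (f := fun v (_ : v ∈ Set.Ioi (u - (J : ℤ))) => F v) v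
      (Finset.mem_Ioc.1 hv).1 le_rfl _ (hW v (measurableSet_singleton 0))
  · refine MeasurableSet.iInter fun j => ?_
    exact le_iSup₂_of_le (f := fun v (_ : v ∈ Set.Iic (u - (J : ℤ))) => F v) (u - J - j)
      (by simp) le_rfl _ (hW _ measurableSet_Iic)

/-- Having arbitrarily early cut times is a tail event at `-∞`, of probability `0` or `1` by
Kolmogorov. It is a decreasing intersection of events of probability at least `δ`, which excludes
`0`. -/
theorem ae_hasCutTimes [IsProbabilityMeasure P] (hF : ∀ v, F v ≤ mΩ) (hi : iIndep F P)
    (hW : ∀ v, Measurable[F v] (W v)) (hlaw : ∀ v k, P (W v ⁻¹' {k}) = μ k)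
    (h0 : μ 0 ≠ 0) (hsum : ∑' k, tail μ k ≠ ⊤) :
    ∀ᵐ o ∂P, HasCutTimes fun v => W v o := by
  obtain ⟨δ, hδ, hle⟩ := exists_le_measure_cut hF hi hW hlaw h0 hsum
  have hC : ∀ u n : ℤ, u ≤ n → MeasurableSet[past F n] {o | ∀ j : ℕ, W (u - j) o ≤ j} := by
    intro u n hun
    rw [Set.ofPred_forall]
    exact MeasurableSet.iInter fun j =>
      le_past F (show u - j ≤ n by omega) _ (hW _ (measurableSet_Iic (a := j)))
  set L : Set Ω := {o | HasCutTimes fun v => W v o} with hL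
  -- Only early times matter, so the event can be written with times up to an arbitrary `n`; it then
  -- belongs to every `past F n`.
  have hrep : ∀ n : ℤ, L = ⋂ m ∈ Set.Iic n, ⋃ u ∈ Set.Iic m, {o | ∀ j : ℕ, W (u - j) o ≤ j} := by
    intro n
    ext o
    simp only [hL, HasCutTimes, Set.mem_ofPred_eq, Set.mem_iInter, Set.mem_iUnion, Set.mem_Iic,
      exists_prop]
    refine ⟨fun h m _ => h m, fun h m => ?_⟩
    obtain ⟨u, hu, h'⟩ := h (min m n) (min_le_right _ _)
    exact ⟨u, hu.trans (min_le_left _ _), h'⟩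
  have hpast : ∀ n, MeasurableSet[past F n] L := by
    intro n
    rw [hrep n]
    refine MeasurableSet.biInter (Set.to_countable _) fun m hm => ?_
    exact MeasurableSet.biUnion (Set.to_countable _) fun u hu => hC u n (le_trans hu hm)
  have htail : MeasurableSet[limsup F atBot] L := by
    rw [(atBot_basis : (atBot : Filter ℤ).HasBasis _ _).limsup_eq_iInf_iSup]
    simp only [MeasurableSpace.measurableSet_iInf]
    exact fun n _ => hpast n
  have hLm : MeasurableSet L := past_le hF 0 _ (hpast 0)
  have hpos : δ ≤ P L := by
    have e : L = ⋂ n : ℕ, ⋃ u ∈ Set.Iic (-(n : ℤ)), {o | ∀ j : ℕ, W (u - j) o ≤ j} := by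
      ext o
      simp only [hL, HasCutTimes, Set.mem_ofPred_eq, Set.mem_iInter, Set.mem_iUnion, Set.mem_Iic,
        exists_prop]
      refine ⟨fun h m => h _, fun h m => ?_⟩
      obtain ⟨u, hu, h'⟩ := h (-m).toNat
      exact ⟨u, by omega, h'⟩
    rw [e, Antitone.measure_iInter]
    · refine le_iInf fun n => (hle (-(n : ℤ))).trans (measure_mono ?_)
      exact Set.subset_biUnion_of_mem (u := fun u : ℤ => {o | ∀ j : ℕ, W (u - j) o ≤ j})
        (Set.mem_Iic.2 le_rfl)
    · intro a b hab
      exact Set.biUnion_subset_biUnion_left (Set.Iic_subset_Iic.2 (by simpa using hab))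
    · exact fun n => (MeasurableSet.biUnion (Set.to_countable _) fun u hu =>
        past_le hF _ _ (hC u _ hu)).nullMeasurableSet
    · exact ⟨0, measure_ne_top _ _⟩
  rcases measure_zero_or_one_of_measurableSet_limsup_atBot hF hi htail with h | h
  · exact absurd (h ▸ hpos) (not_le_of_gt hδ)
  · exact (mem_ae_iff_prob_eq_one hLm).2 h

theorem measure_chainFrom_eq [IsProbabilityMeasure P] (hF : ∀ v, F v ≤ mΩ) (hi : iIndep F P)
    (hW : ∀ v, Measurable[F v] (W v)) (hlaw : ∀ v k, P (W v ⁻¹' {k}) = μ k) (K K' n : ℕ) :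
    ∀ k, P ((fun o => chainFrom (fun v => W v o) K n) ⁻¹' {k})
      = P ((fun o => chainFrom (fun v => W v o) K' n) ⁻¹' {k}) := by
  induction n with
  | zero => intro k; rfl
  | succ n ih =>
    intro k
    have step := fun K : ℕ => measure_inter_step hF hi hW hlaw (measurable_chainFrom hW K n)
      (X' := fun o => chainFrom (fun v => W v o) K (n + 1)) (Eventually.of_forall fun o => rfl)
      MeasurableSet.univ k
    simp only [Set.univ_inter] at step
    rw [step, step, ih, ih]

/-- The law at time `t` is the limit of the laws after `t + K` steps from `0`, which do not depend
on the starting time. Passing to `t + 1` merely shifts this convergent sequence. -/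
theorem limitChain_stationary [IsProbabilityMeasure P] (hF : ∀ v, F v ≤ mΩ) (hi : iIndep F P)
    (hW : ∀ v, Measurable[F v] (W v)) (hlaw : ∀ v k, P (W v ⁻¹' {k}) = μ k)
    (hcut : ∀ᵐ o ∂P, HasCutTimes fun v => W v o) (t : ℤ) (k : ℕ) :
    P ((fun o => limitChain (fun v => W v o) (t + 1)) ⁻¹' {k})
      = P ((fun o => limitChain (fun v => W v o) t) ⁻¹' {k}) := by
  have hlim : ∀ t : ℤ, Tendsto (fun K : ℕ =>
      P ((fun o => chainFrom (fun v => W v o) 0 (t + K).toNat) ⁻¹' {k})) atTop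
      (𝓝 (P ((fun o => limitChain (fun v => W v o) t) ⁻¹' {k}))) := by
    intro t
    have := tendsto_measure_of_ae_tendsto_indicator_of_isFiniteMeasure (μ := P) atTop
      (A := (fun o => limitChain (fun v => W v o) t) ⁻¹' {k})
      (As := fun K : ℕ => (fun o => chainFrom (fun v => W v o) K (t + K).toNat) ⁻¹' {k})
      (past_le hF _ _ (measurable_limitChain hW t (measurableSet_singleton k)))
      (fun K => past_le hF _ _ (measurable_chainFrom hW K _ (measurableSet_singleton k)))
      (by
        filter_upwards [hcut] with o ho
        filter_upwards [ho.eventually_eq t] with K hK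
        simp [hK])
    refine this.congr fun K => measure_chainFrom_eq hF hi hW hlaw K 0 _ k
  refine tendsto_nhds_unique (hlim (t + 1)) ?_
  refine ((tendsto_add_atTop_iff_nat 1).2 (hlim t)).congr fun K => ?_
  rw [show t + 1 + (K : ℤ) = t + ((K + 1 : ℕ) : ℤ) by push_cast; ring]

/-- Iterating the recursion telescopes, and the remainder `q (k + n)` tends to `0` by summability.
-/
theorem eq_mul_tail {q : ℕ → ℝ≥0∞} (hq : ∑' k, q k ≠ ⊤) (h : ∀ k, q k = q (k + 1) + q 0 * μ k)
    (k : ℕ) : q k = q 0 * tail μ k := by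
  have hn : ∀ n, q k = q (k + n) + q 0 * ∑ j ∈ Finset.range n, μ (j + k) := by
    intro n
    induction n with
    | zero => simp
    | succ n ih =>
      rw [ih, h (k + n), Finset.sum_range_succ, mul_add, add_comm n k,
        add_assoc, add_comm (q 0 * μ (k + n)), add_assoc k n 1]
  have ht : tail μ k = ∑' j, μ (j + k) := by
    rw [tail, ← (ENNReal.summable).sum_add_tsum_nat_add' (k := k)]
    · rw [Finset.sum_eq_zero fun i hi => if_neg (by simpa using hi), zero_add]
      simp
  have h0 : Tendsto q atTop (𝓝 0) := ENNReal.tendsto_atTop_zero_of_tsum_ne_top hq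
  have h1 : Tendsto (fun n => q (k + n) + q 0 * ∑ j ∈ Finset.range n, μ (j + k)) atTop
      (𝓝 (0 + q 0 * tail μ k)) := by
    refine Tendsto.add ?_ ?_
    · simpa only [add_comm k] using (tendsto_add_atTop_iff_nat k).2 h0
    · refine ENNReal.Tendsto.const_mul ?_ (Or.inr (ENNReal.ne_top_of_tsum_ne_top hq 0))
      rw [ht]
      exact ENNReal.tendsto_nat_tsum _
  rw [zero_add] at h1
  exact tendsto_nhds_unique (tendsto_const_nhds.congr hn) h1

/-- The stationary law of the limit chain. -/
theorem measure_limitChain_eq [IsProbabilityMeasure P] (hF : ∀ v, F v ≤ mΩ) (hi : iIndep F P)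
    (hW : ∀ v, Measurable[F v] (W v)) (hlaw : ∀ v k, P (W v ⁻¹' {k}) = μ k)
    (hcut : ∀ᵐ o ∂P, HasCutTimes fun v => W v o) {M : ℝ≥0∞} (hM : M ≠ ⊤) (hM0 : M ≠ 0)
    (htail : ∑' k, tail μ k / M = 1) (t : ℤ) (k : ℕ) :
    P ((fun o => limitChain (fun v => W v o) t) ⁻¹' {k}) = tail μ k / M := by
  set q := fun k => P ((fun o => limitChain (fun v => W v o) t) ⁻¹' {k}) with hqdef
  have hq1 : ∑' k, q k = 1 := tsum_measure_preimage_singleton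
    ((measurable_limitChain hW t).mono (past_le hF t) le_rfl)
  have hrec : ∀ k, q k = q (k + 1) + q 0 * μ k := by
    intro k
    have := measure_inter_step hF hi hW hlaw (measurable_limitChain hW t)
      (X' := fun o => limitChain (fun v => W v o) (t + 1))
      (hcut.mono fun o ho => ho.limitChain_succ t) MeasurableSet.univ k
    simp only [Set.univ_inter] at this
    rw [limitChain_stationary hF hi hW hlaw hcut t k] at this
    exact this
  have hq := eq_mul_tail (hq1 ▸ ENNReal.one_ne_top) hrec
  have hsum : ∑' k, tail μ k = M := by
    simp only [div_eq_mul_inv, ENNReal.tsum_mul_right] at htail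
    rw [← div_eq_mul_inv] at htail
    exact (ENNReal.div_eq_one_iff hM0 hM).1 htail
  -- Total mass one fixes the remaining free constant `q 0`.
  have h2 : q 0 * M = 1 := by
    rw [← hsum, ← ENNReal.tsum_mul_left, ← hq1]
    exact tsum_congr fun k => (hq k).symm
  change q k = _
  rw [hq k, ENNReal.eq_inv_of_mul_eq_one_left h2, mul_comm, div_eq_mul_inv]

end

end RenewalField

namespace RenewalField

/-! ### Grouping independent σ-algebras -/

section Grouping

variable {Ω ι κ : Type*} {mΩ : MeasurableSpace Ω} {P : Measure Ω}

/-- The σ-algebra generated by the `m i` with `g i = k`. -/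
abbrev fiberAlg (m : ι → MeasurableSpace Ω) (g : ι → κ) (k : κ) : MeasurableSpace Ω :=
  ⨆ i ∈ g ⁻¹' {k}, m i

theorem le_fiberAlg (m : ι → MeasurableSpace Ω) (g : ι → κ) (i : ι) : m i ≤ fiberAlg m g (g i) :=
  le_iSup₂_of_le (f := fun i (_ : i ∈ g ⁻¹' {g _}) => m i) i rfl le_rfl

theorem fiberAlg_le {m : ι → MeasurableSpace Ω} (hm : ∀ i, m i ≤ mΩ) (g : ι → κ) (k : κ) :
    fiberAlg m g k ≤ mΩ := iSup₂_le fun i _ => hm i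

/-- This serves twice: to merge the three driving variables of a site, and to merge the sites of a
column. -/
theorem iIndep_fiberAlg {m : ι → MeasurableSpace Ω} (hm : ∀ i, m i ≤ mΩ) (hi : iIndep m P)
    (g : ι → κ) : iIndep (fiberAlg m g) P := by
  classical
  have := hi.isProbabilityMeasure
  rw [iIndep_iff]
  intro s f
  induction s using Finset.induction_on with
  | empty => simp
  | insert a s ha ih =>
    intro hf
    have hf' : ∀ i ∈ s, MeasurableSet[fiberAlg m g i] (f i) := fun i h =>
      hf i (Finset.mem_insert_of_mem h)
    rw [Finset.prod_insert ha, ← ih hf', Finset.set_biInter_insert]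
    have hd : Disjoint (g ⁻¹' {a}) (g ⁻¹' (s : Set κ)) :=
      Disjoint.preimage _ (by simpa using ha)
    refine (Indep_iff _ _ P).1 (indep_iSup_of_disjoint hm hi hd) _ _
      (hf a (Finset.mem_insert_self _ _)) ?_
    refine Finset.measurableSet_biInter _ fun k hk => ?_
    have hle : fiberAlg m g k ≤ ⨆ i ∈ g ⁻¹' (s : Set κ), m i := by
      refine iSup₂_le fun i hik => ?_
      refine le_iSup₂_of_le (f := fun i (_ : i ∈ g ⁻¹' (s : Set κ)) => m i) i ?_ le_rfl
      rw [Set.mem_preimage, show g i = k from hik]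
      exact hk
    exact hle _ (hf' k hk)

end Grouping

/-! ### Independence of the marked renewals in one column -/

section OneSite

variable {Ω : Type*} {mΩ : MeasurableSpace Ω} {P : Measure Ω}
variable {F : ℤ → MeasurableSpace Ω} {W V Z : ℤ → Ω → ℕ} {μ q : ℕ → ℝ≥0∞} {γ : ℝ≥0∞}

/-- The marked renewal at time `t`: the limit chain vanishes and the next mark is `1`. -/
def markedRenewal (W Z : ℤ → Ω → ℕ) (t : ℤ) : Set Ω :=
  {o | limitChain (fun v => W v o) t = 0 ∧ Z (t + 1) o = 1}

theorem measurableSet_markedRenewal (hW : ∀ v, Measurable[F v] (W v))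
    (hZ : ∀ v, Measurable[F v] (Z v)) (t : ℤ) :
    MeasurableSet[past F (t + 1)] (markedRenewal W Z t) :=
  MeasurableSet.inter
    (past_mono F (show t ≤ t + 1 by omega) _ (measurable_limitChain hW t (measurableSet_singleton 0)))
    (le_past F le_rfl _ (hZ (t + 1) (measurableSet_singleton 1)))

theorem measurableSet_biInter_markedRenewal (hW : ∀ v, Measurable[F v] (W v))
    (hZ : ∀ v, Measurable[F v] (Z v)) {T : Finset ℤ} {n : ℤ} (hT : ∀ t ∈ T, t < n) :
    MeasurableSet[past F n] (⋂ t ∈ T, markedRenewal W Z t) :=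
  Finset.measurableSet_biInter _ fun t ht =>
    past_mono F (Int.add_one_le_of_lt (hT t ht)) _ (measurableSet_markedRenewal hW hZ t)

/-- The induction closes because the state at time `n` is carried along: given the marked renewals
before `n`, it keeps the stationary law `q`. A marked renewal at the last time replaces the state by
an independent variable of law `q`; if the last time is not in `T`, an ordinary step preserves `q`.
-/
theorem measure_biInter_markedRenewal_inter [IsProbabilityMeasure P] (hF : ∀ v, F v ≤ mΩ)
    (hi : iIndep F P) (hW : ∀ v, Measurable[F v] (W v)) (hV : ∀ v, Measurable[F v] (V v))
    (hZ : ∀ v, Measurable[F v] (Z v)) (hlaw : ∀ v k, P (W v ⁻¹' {k}) = μ k)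
    (hWV : ∀ v o, Z v o = 1 → W v o = V v o)
    (hZV : ∀ v k, P (Z v ⁻¹' {1} ∩ V v ⁻¹' {k}) = γ * q k)
    (hcut : ∀ᵐ o ∂P, HasCutTimes fun v => W v o)
    (hq : ∀ t k, P ((fun o => limitChain (fun v => W v o) t) ⁻¹' {k}) = q k) (d : ℕ) :
    ∀ (n : ℤ) (T : Finset ℤ), (∀ t ∈ T, n - d ≤ t ∧ t < n) → ∀ k,
      P ((⋂ t ∈ T, markedRenewal W Z t) ∩ (fun o => limitChain (fun v => W v o) n) ⁻¹' {k})
        = (γ * q 0) ^ T.card * q k := by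
  induction d with
  | zero =>
    intro n T hT k
    obtain rfl : T = ∅ := Finset.eq_empty_of_forall_notMem fun t ht => by
      have := hT t ht; push_cast at this; omega
    simp [hq]
  | succ d ih =>
    intro n' T hT k
    obtain ⟨n, rfl⟩ : ∃ n, n' = n + 1 := ⟨n' - 1, by ring⟩
    by_cases hn : n ∈ T
    · set T' := T.erase n with hT'
      have hT'' : ∀ t ∈ T', n - d ≤ t ∧ t < n := by
        intro t ht
        have h1 := hT t (Finset.mem_of_mem_erase ht)
        have h2 := Finset.ne_of_mem_erase ht
        push_cast at h1; omega
      have hA := measurableSet_biInter_markedRenewal hW hZ fun t ht => (hT'' t ht).2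
      have h0 : MeasurableSet[past F n] ((⋂ t ∈ T', markedRenewal W Z t) ∩
          (fun o => limitChain (fun v => W v o) n) ⁻¹' {0}) :=
        MeasurableSet.inter hA (measurable_limitChain hW n (measurableSet_singleton 0))
      have h1 : MeasurableSet[F (n + 1)] (Z (n + 1) ⁻¹' {1} ∩ V (n + 1) ⁻¹' {k}) :=
        MeasurableSet.inter (hZ _ (measurableSet_singleton 1)) (hV _ (measurableSet_singleton k))
      have hind := (Indep_iff _ _ P).1 (indep_past hF hi (lt_add_one n)) _ _ h0 h1
      rw [ih n T' hT'' 0, hZV] at hind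
      have hcard : T.card = T'.card + 1 := (Finset.card_erase_add_one hn).symm
      rw [hcard, pow_succ, mul_assoc, mul_assoc, mul_left_comm γ, ← mul_assoc _ (q 0), ← hind,
        ← Finset.insert_erase hn, ← hT', Finset.set_biInter_insert]
      refine measure_congr ?_
      filter_upwards [hcut] with o ho
      refine propext ?_
      generalize hB : (⋂ t ∈ T', markedRenewal W Z t) = B
      change (((limitChain (fun v => W v o) n = 0 ∧ Z (n + 1) o = 1) ∧ o ∈ B) ∧
        limitChain (fun v => W v o) (n + 1) = k) ↔ (o ∈ B ∧ limitChain (fun v => W v o) n = 0) ∧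
          Z (n + 1) o = 1 ∧ V (n + 1) o = k
      rw [ho.limitChain_succ]
      constructor
      · rintro ⟨⟨⟨a, b⟩, c⟩, e⟩
        rw [if_pos a, hWV _ _ b] at e
        exact ⟨⟨c, a⟩, b, e⟩
      · rintro ⟨⟨c, a⟩, b, e⟩
        rw [if_pos a, hWV _ _ b]
        exact ⟨⟨⟨a, b⟩, c⟩, e⟩
    · have hT' : ∀ t ∈ T, n - d ≤ t ∧ t < n := by
        intro t ht
        have h1 := hT t ht
        have h2 : t ≠ n := fun h => hn (h ▸ ht)
        push_cast at h1; omega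
      have step := fun {A : Set Ω} (hA : MeasurableSet[past F n] A) =>
        measure_inter_step hF hi hW hlaw (measurable_limitChain hW n)
          (X' := fun o => limitChain (fun v => W v o) (n + 1))
          (hcut.mono fun o ho => ho.limitChain_succ n) hA k
      -- The one-step formula is used on the marked event and on the whole space. The second use is
      -- the stationarity equation of `q`, and the first is that equation times the probability of
      -- the marks.
      have h1 := step (measurableSet_biInter_markedRenewal hW hZ fun t ht => (hT' t ht).2)
      have h2 := step MeasurableSet.univ
      simp only [Set.univ_inter, hq] at h2
      rw [h1, ih n T hT', ih n T hT', mul_assoc, ← mul_add, ← h2]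

theorem measure_inter_eq_tsum {X : Ω → ℕ} (hX : Measurable X) (A : Set Ω) :
    P A = ∑' k, P (A ∩ X ⁻¹' {k}) := by
  have h := measure_preimage_eq_tsum (P := P.restrict A) hX Set.univ
  simp only [Set.preimage_univ, Measure.restrict_apply_univ, Set.mem_univ, if_true] at h
  rw [h]
  refine tsum_congr fun k => ?_
  rw [Measure.restrict_apply (hX (measurableSet_singleton k)), Set.inter_comm]

theorem measure_biInter_markedRenewal [IsProbabilityMeasure P] (hF : ∀ v, F v ≤ mΩ)
    (hi : iIndep F P) (hW : ∀ v, Measurable[F v] (W v)) (hV : ∀ v, Measurable[F v] (V v))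
    (hZ : ∀ v, Measurable[F v] (Z v)) (hlaw : ∀ v k, P (W v ⁻¹' {k}) = μ k)
    (hWV : ∀ v o, Z v o = 1 → W v o = V v o)
    (hZV : ∀ v k, P (Z v ⁻¹' {1} ∩ V v ⁻¹' {k}) = γ * q k)
    (hcut : ∀ᵐ o ∂P, HasCutTimes fun v => W v o)
    (hq : ∀ t k, P ((fun o => limitChain (fun v => W v o) t) ⁻¹' {k}) = q k) (T : Finset ℤ) :
    P (⋂ t ∈ T, markedRenewal W Z t) = (γ * q 0) ^ T.card := by
  obtain ⟨b, hb⟩ := T.bddAbove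
  obtain ⟨a, ha⟩ := T.bddBelow
  have hX : ∀ t, Measurable fun o => limitChain (fun v => W v o) t := fun t =>
    (measurable_limitChain hW t).mono (past_le hF t) le_rfl
  rw [measure_inter_eq_tsum (hX (b + 1))]
  have key := measure_biInter_markedRenewal_inter hF hi hW hV hZ hlaw hWV hZV hcut hq
    (b + 1 - a).toNat (b + 1) T (fun t ht => by
      have h1 : a ≤ t := ha ht
      have h2 : t ≤ b := hb ht
      omega)
  simp_rw [key, ENNReal.tsum_mul_left]
  have : ∑' k, q k = 1 := by
    simp_rw [← hq 0]; exact tsum_measure_preimage_singleton (hX 0)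
  rw [this, mul_one]

end OneSite

end RenewalField

namespace RenewalField

/-! ### The Bernoulli field of marked renewals -/

section Driving

variable {d : ℕ} {Ω : Type*} {V Z Y : Site d → Ω → ℕ}

/-- The σ-algebra generated by the three driving variables at `z`. -/
abbrev siteAlg (V Z Y : Site d → Ω → ℕ) (z : Site d) : MeasurableSpace Ω :=
  fiberAlg (fun i : Site d ⊕ (Site d ⊕ Site d) =>
    MeasurableSpace.comap (Sum.elim V (Sum.elim Z Y) i) inferInstance)
    (Sum.elim id (Sum.elim id id)) z

/-- The marked renewal at the space-time point `z`, in the environment. -/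
def renewalEvent (V Z Y : Site d → Ω → ℕ) (z : Site d) : Set Ω :=
  {o | environment (jumps (fun w => V w o) (fun w => Z w o) (fun w => Y w o)) z = 0 ∧
    Z (z.1, z.2 + 1) o = 1}

/-- The density of the marked renewals. -/
noncomputable def renewalDensity (μ : PMF ℕ) : ℝ≥0∞ := gammaConst μ * stationaryMass μ 0

theorem measurable_V_siteAlg (z : Site d) : Measurable[siteAlg V Z Y z] (V z) :=
  (comap_measurable (V z)).mono (le_fiberAlg (fun i : Site d ⊕ (Site d ⊕ Site d) =>
    MeasurableSpace.comap (Sum.elim V (Sum.elim Z Y) i) inferInstance)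
    (Sum.elim id (Sum.elim id id)) (Sum.inl z)) le_rfl

theorem measurable_Z_siteAlg (z : Site d) : Measurable[siteAlg V Z Y z] (Z z) :=
  (comap_measurable (Z z)).mono (le_fiberAlg (fun i : Site d ⊕ (Site d ⊕ Site d) =>
    MeasurableSpace.comap (Sum.elim V (Sum.elim Z Y) i) inferInstance)
    (Sum.elim id (Sum.elim id id)) (Sum.inr (Sum.inl z))) le_rfl

theorem measurable_Y_siteAlg (z : Site d) : Measurable[siteAlg V Z Y z] (Y z) :=
  (comap_measurable (Y z)).mono (le_fiberAlg (fun i : Site d ⊕ (Site d ⊕ Site d) =>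
    MeasurableSpace.comap (Sum.elim V (Sum.elim Z Y) i) inferInstance)
    (Sum.elim id (Sum.elim id id)) (Sum.inr (Sum.inr z))) le_rfl

theorem measurable_jumps_siteAlg (z : Site d) : Measurable[siteAlg V Z Y z]
    fun o => jumps (fun w => V w o) (fun w => Z w o) (fun w => Y w o) z := by
  have h : Measurable[siteAlg V Z Y z] fun o => (V z o, Z z o, Y z o) :=
    (measurable_V_siteAlg z).prodMk ((measurable_Z_siteAlg z).prodMk (measurable_Y_siteAlg z))
  exact (measurable_of_countable fun p : ℕ × ℕ × ℕ => p.2.1 * p.1 + (1 - p.2.1) * p.2.2).comp h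

variable [mΩ : MeasurableSpace Ω] {P : Measure Ω} {μ ν : PMF ℕ}

namespace IsDriving

theorem measurable_sum (h : IsDriving P μ ν V Z Y) (i : Site d ⊕ (Site d ⊕ Site d)) :
    Measurable (Sum.elim V (Sum.elim Z Y) i) := by
  rcases i with z | z | z
  exacts [h.measurable_V z, h.measurable_Z z, h.measurable_Y z]

theorem siteAlg_le (h : IsDriving P μ ν V Z Y) (z : Site d) : siteAlg V Z Y z ≤ mΩ :=
  fiberAlg_le (fun i => (h.measurable_sum i).comap_le) _ z

theorem iIndep_siteAlg (h : IsDriving P μ ν V Z Y) : iIndep (siteAlg V Z Y) P :=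
  iIndep_fiberAlg (fun i => (h.measurable_sum i).comap_le) h.indep.iIndep _

theorem measure_Z_inter_V (h : IsDriving P μ ν V Z Y) (z : Site d) (k : ℕ) :
    P (Z z ⁻¹' {1} ∩ V z ⁻¹' {k}) = gammaConst μ * stationaryMass μ k := by
  have hind : IndepFun (Z z) (V z) P := by
    simpa using h.indep.indepFun (i := Sum.inr (Sum.inl z)) (j := Sum.inl z) (by simp)
  rw [hind.measure_inter_preimage_eq_mul _ _ (measurableSet_singleton 1)
    (measurableSet_singleton k), h.law_Z_one, h.law_V]

theorem measure_Z_inter_Y (h : IsDriving P μ ν V Z Y) (z : Site d) (k : ℕ) :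
    P (Z z ⁻¹' {0} ∩ Y z ⁻¹' {k}) = (1 - gammaConst μ) * ν k := by
  have hind : IndepFun (Z z) (Y z) P := by
    simpa using h.indep.indepFun (i := Sum.inr (Sum.inl z)) (j := Sum.inr (Sum.inr z)) (by simp)
  rw [hind.measure_inter_preimage_eq_mul _ _ (measurableSet_singleton 0)
    (measurableSet_singleton k), h.law_Z_zero, h.law_Y]

variable [IsProbabilityMeasure P]

theorem gammaConst_le_one (h : IsDriving P μ ν V Z Y) (z : Site d) : gammaConst μ ≤ 1 :=
  h.law_Z_one z ▸ prob_le_one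

theorem ae_Z (h : IsDriving P μ ν V Z Y) (z : Site d) : ∀ᵐ o ∂P, Z z o = 0 ∨ Z z o = 1 := by
  have h0 := h.measurable_Z z (measurableSet_singleton 0)
  have h1 := h.measurable_Z z (measurableSet_singleton 1)
  have hu : P (Z z ⁻¹' {0} ∪ Z z ⁻¹' {1}) = 1 := by
    rw [measure_union _ h1, h.law_Z_zero, h.law_Z_one, tsub_add_cancel_of_le (h.gammaConst_le_one z)]
    rw [Set.disjoint_left]
    intro o ha hb
    simp only [Set.mem_preimage, Set.mem_singleton_iff] at ha hb
    omega
  exact (mem_ae_iff_prob_eq_one (h0.union h1)).2 hu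

theorem measure_jumps (h : IsDriving P μ ν V Z Y) (hν : IsResidualLaw μ ν) (z : Site d) (k : ℕ) :
    P ((fun o => jumps (fun w => V w o) (fun w => Z w o) (fun w => Y w o) z) ⁻¹' {k}) = μ k := by
  rw [← hν k, ← h.measure_Z_inter_V z k, ← h.measure_Z_inter_Y z k, ← measure_union]
  · refine measure_congr ?_
    filter_upwards [h.ae_Z z] with o ho
    refine propext ?_
    change Z z o * V z o + (1 - Z z o) * Y z o = k ↔
      (Z z o = 1 ∧ V z o = k) ∨ (Z z o = 0 ∧ Y z o = k)
    rcases ho with h | h <;> simp [h]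
  · rw [Set.disjoint_left]
    rintro o ⟨ha, _⟩ ⟨hb, _⟩
    simp only [Set.mem_preimage, Set.mem_singleton_iff] at ha hb
    omega
  · exact (h.measurable_Z z (measurableSet_singleton 0)).inter
      (h.measurable_Y z (measurableSet_singleton k))

end IsDriving

theorem tail_zero (μ : PMF ℕ) : tail (fun k => μ k) 0 = 1 := by
  simp [tail, μ.tsum_coe]

theorem stationaryMass_zero (μ : PMF ℕ) : stationaryMass μ 0 = (mean μ + 1)⁻¹ := by
  rw [← one_div, stationaryMass]
  congr 1
  exact tail_zero μ

theorem mean_ne_top {p : ℝ} (hp : 1 ≤ p) (h : moment μ p < ⊤) : mean μ ≠ ⊤ := by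
  refine ne_top_of_le_ne_top h.ne (ENNReal.tsum_le_tsum fun n => ?_)
  gcongr
  rcases Nat.eq_zero_or_pos n with rfl | hn
  · simp
  · conv_lhs => rw [← ENNReal.rpow_one (n : ℝ≥0∞)]
    exact ENNReal.rpow_le_rpow_of_exponent_le (by exact_mod_cast hn) hp

/-- At `k = 0` this gives `μ 0 > 0`, which the construction of cut times needs. -/
theorem gammaConst_mul_stationaryMass_le (μ : PMF ℕ) (k : ℕ) :
    gammaConst μ * stationaryMass μ k ≤ μ k := by
  rcases eq_or_ne (stationaryMass μ k) 0 with h0 | h0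
  · simp [h0]
  · have h1 : stationaryMass μ k ≠ ⊤ := by
      refine ENNReal.div_ne_top ?_ (by simp)
      refine ne_top_of_le_ne_top (b := 1) ENNReal.one_ne_top ?_
      rw [← μ.tsum_coe]
      exact ENNReal.tsum_le_tsum fun n => by split_ifs <;> simp
    rw [← ENNReal.le_div_iff_mul_le (Or.inl h0) (Or.inl h1)]
    exact iInf₂_le (f := fun k (_ : 0 < stationaryMass μ k) => μ k / stationaryMass μ k) k
      (pos_iff_ne_zero.2 h0)

theorem renewalDensity_pos (hM : mean μ ≠ ⊤) (hγ : 0 < gammaConst μ) : 0 < renewalDensity μ := by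
  rw [renewalDensity, stationaryMass_zero]
  exact ENNReal.mul_pos hγ.ne' (by simp [hM])

namespace IsDriving

variable [IsProbabilityMeasure P]

theorem tsum_stationaryMass (h : IsDriving P μ ν V Z Y) (z : Site d) :
    ∑' k, stationaryMass μ k = 1 := by
  simp_rw [← h.law_V z]
  exact tsum_measure_preimage_singleton (h.measurable_V z)

theorem measurable_and_measure_column (h : IsDriving P μ ν V Z Y) (hM : mean μ ≠ ⊤)
    (hγ : 0 < gammaConst μ) (hν : IsResidualLaw μ ν) (x : Fin d → ℤ) :
    (∀ t, MeasurableSet[fiberAlg (siteAlg V Z Y) Prod.fst x] (renewalEvent V Z Y (x, t))) ∧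
    ∀ T : Finset ℤ, P (⋂ t ∈ T, renewalEvent V Z Y (x, t)) = renewalDensity μ ^ T.card := by
  set F : ℤ → MeasurableSpace Ω := fun t => siteAlg V Z Y (x, t) with hFdef
  set W : ℤ → Ω → ℕ := fun t o => jumps (fun w => V w o) (fun w => Z w o) (fun w => Y w o) (x, t)
    with hWdef
  have hF : ∀ v, F v ≤ mΩ := fun v => h.siteAlg_le _
  have hi : iIndep F P := h.iIndep_siteAlg.precomp (g := fun t : ℤ => (x, t))
    (Prod.mk_right_injective x)
  have hW : ∀ v, Measurable[F v] (W v) := fun v => measurable_jumps_siteAlg (x, v)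
  have hZ : ∀ v, Measurable[F v] (Z (x, v)) := fun v => measurable_Z_siteAlg (x, v)
  have hV : ∀ v, Measurable[F v] (V (x, v)) := fun v => measurable_V_siteAlg (x, v)
  have hlaw : ∀ v k, P (W v ⁻¹' {k}) = μ k := fun v k => h.measure_jumps hν (x, v) k
  have hM1 : mean μ + 1 ≠ ⊤ := ENNReal.add_ne_top.2 ⟨hM, ENNReal.one_ne_top⟩
  -- The normalisation of `μ̂` comes for free, since `V` has this law. It also makes the series of
  -- tails finite.
  have htail : ∑' k, tail (fun k => μ k) k / (mean μ + 1) = 1 := h.tsum_stationaryMass (x, 0)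
  have hsum : ∑' k, tail (fun k => μ k) k ≠ ⊤ := by
    intro htop
    simp only [div_eq_mul_inv, ENNReal.tsum_mul_right, htop] at htail
    rw [ENNReal.top_mul (by simpa using hM)] at htail
    exact ENNReal.top_ne_one htail
  have hμ0 : μ 0 ≠ 0 := ((renewalDensity_pos hM hγ).trans_le
    (gammaConst_mul_stationaryMass_le μ 0)).ne'
  have hcut := ae_hasCutTimes hF hi hW hlaw hμ0 hsum
  have hq : ∀ t k, P ((fun o => limitChain (fun v => W v o) t) ⁻¹' {k}) = stationaryMass μ k :=
    measure_limitChain_eq hF hi hW hlaw hcut hM1 (by simp) htail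
  refine ⟨fun t => ?_, fun T => ?_⟩
  -- On a column, `environment` is by definition the limit chain of the jumps there, so
  -- `renewalEvent` unfolds to `markedRenewal`.
  · have h1 := measurableSet_markedRenewal hW hZ t
    have hle : past F (t + 1) ≤ fiberAlg (siteAlg V Z Y) Prod.fst x :=
      iSup₂_le fun v _ => le_fiberAlg (siteAlg V Z Y) Prod.fst (x, v)
    exact hle _ h1
  · refine measure_biInter_markedRenewal hF hi hW hV hZ hlaw ?_
      (fun v k => h.measure_Z_inter_V (x, v) k) hcut hq T
    intro v o ho
    simp [hWdef, jumps, ho]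

theorem measurableSet_renewalEvent (h : IsDriving P μ ν V Z Y) (hM : mean μ ≠ ⊤)
    (hγ : 0 < gammaConst μ) (hν : IsResidualLaw μ ν) (z : Site d) :
    MeasurableSet (renewalEvent V Z Y z) :=
  fiberAlg_le h.siteAlg_le _ _ _ ((h.measurable_and_measure_column hM hγ hν z.1).1 z.2)

theorem measure_renewalEvent (h : IsDriving P μ ν V Z Y) (hM : mean μ ≠ ⊤)
    (hγ : 0 < gammaConst μ) (hν : IsResidualLaw μ ν) (z : Site d) :
    P (renewalEvent V Z Y z) = renewalDensity μ := by
  simpa using (h.measurable_and_measure_column hM hγ hν z.1).2 {z.2}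

/-- The marked renewals form a Bernoulli field: a marked renewal restarts the chain from its
stationary law. -/
theorem iIndepSet_renewalEvent (h : IsDriving P μ ν V Z Y) (hM : mean μ ≠ ⊤)
    (hγ : 0 < gammaConst μ) (hν : IsResidualLaw μ ν) :
    iIndepSet (renewalEvent V Z Y) P := by
  classical
  rw [iIndepSet_iff_meas_biInter (h.measurableSet_renewalEvent hM hγ hν)]
  intro S
  simp_rw [h.measure_renewalEvent hM hγ hν, Finset.prod_const]
  have hcol := h.measurable_and_measure_column hM hγ hν
  set T : (Fin d → ℤ) → Finset ℤ := fun x => (S.filter fun z => z.1 = x).image Prod.snd with hT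
  have hmemT : ∀ x t, t ∈ T x ↔ (x, t) ∈ S := by
    intro x t
    simp only [hT, Finset.mem_image, Finset.mem_filter, Prod.exists]
    constructor
    · rintro ⟨a, b, ⟨h1, rfl⟩, rfl⟩; exact h1
    · intro h1; exact ⟨x, t, ⟨h1, rfl⟩, rfl⟩
  have hcard : ∀ x, (T x).card = (S.filter fun z => z.1 = x).card := by
    intro x
    refine Finset.card_image_of_injOn ?_
    intro a ha b hb hab
    simp only [Finset.coe_filter, Set.mem_ofPred_eq] at ha hb
    exact Prod.ext (ha.2.trans hb.2.symm) hab
  have e : (⋂ z ∈ S, renewalEvent V Z Y z)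
      = ⋂ x ∈ S.image Prod.fst, ⋂ t ∈ T x, renewalEvent V Z Y (x, t) := by
    ext o
    simp only [Set.mem_iInter, hmemT, Finset.mem_image]
    constructor
    · intro h1 x _ t ht; exact h1 _ ht
    · intro h1 z hz; exact h1 z.1 ⟨z, hz, rfl⟩ z.2 hz
  -- The columns are independent, and within a column the probability is a power of the density; the
  -- exponents add up to the cardinality of `S`.
  have hind := iIndep_fiberAlg h.siteAlg_le h.iIndep_siteAlg (Prod.fst : Site d → Fin d → ℤ)
  rw [e, hind.meas_biInter fun x _ => Finset.measurableSet_biInter _ fun t _ => (hcol x).1 t]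
  simp_rw [(hcol _).2, hcard]
  rw [Finset.prod_pow_eq_pow_sum, ← Finset.card_eq_sum_card_image]

end IsDriving

end Driving

end RenewalField

namespace RenewalField

/-! ### The cone description of the field and its truncation -/

section Field

variable {d : ℕ} {Ω : Type*}

/-- The temporal radius of the cone over the spatial displacement `y`. -/
noncomputable def coneRadius (R : ℕ) (y : Fin d → ℤ) : ℕ := ⌈‖y‖ / R⌉₊

/-- The event that `z` is marked and that the window over `z.1 + y` contains a marked point, for
all `y ≠ 0` in `N`. -/
def coneEvent (R : ℕ) (E : Site d → Set Ω) (N : Set (Fin d → ℤ)) (z : Site d) : Set Ω :=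
  E z ∩ ⋂ y ∈ {y | y ≠ 0 ∧ y ∈ N},
    ⋃ s ∈ Finset.Ico (1 - (coneRadius R y : ℤ)) (coneRadius R y), E (z.1 + y, z.2 + s)

theorem sInf_int_cast_eq_iff {S : Set ℤ} {a : ℤ} (hS : ∀ t ∈ S, a ≤ t) :
    sInf ((fun t : ℤ => ((t : ℝ) : EReal)) '' S) = ((a : ℝ) : EReal) ↔ a ∈ S := by
  constructor
  · intro h
    by_contra ha
    have : (((a + 1 : ℤ) : ℝ) : EReal) ≤ sInf ((fun t : ℤ => ((t : ℝ) : EReal)) '' S) := by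
      refine le_sInf ?_
      rintro _ ⟨t, ht, rfl⟩
      have h1 : a ≠ t := fun h => ha (h ▸ ht)
      have h2 : a + 1 ≤ t := lt_of_le_of_ne (hS t ht) h1
      exact EReal.coe_le_coe_iff.2 (by exact_mod_cast h2)
    rw [h, EReal.coe_le_coe_iff] at this
    push_cast at this
    linarith
  · intro h
    refine le_antisymm (sInf_le ⟨a, h, rfl⟩) (le_sInf ?_)
    rintro _ ⟨t, ht, rfl⟩
    exact EReal.coe_le_coe_iff.2 (by exact_mod_cast hS t ht)

/-- An infimum lies below a bound exactly when some element does, and an integer is below `‖y‖ / R`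
exactly when it is below the ceiling. So each hitting condition says that a window of `2 *
coneRadius R y - 1` times contains a marked point. -/
theorem eta_eq_one_iff [MeasurableSpace Ω] {R : ℕ} (V Z Y : Site d → Ω → ℕ) (z : Site d) (o : Ω) :
    eta R V Z Y z o = 1 ↔ o ∈ coneEvent R (renewalEvent V Z Y) Set.univ z := by
  have h01 : (0 : Fin 2) ≠ 1 := by decide
  simp only [eta, etaOf, ite_eq_left_iff, h01, imp_false, not_not]
  rw [coneEvent, Set.mem_inter_iff, and_comm]
  refine and_congr ?_ ?_
  · rw [hitTime, sInf_int_cast_eq_iff]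
    · simp [startTime, renewalEvent]
    · rintro t ⟨h, -⟩
      simpa [startTime] using h
  · simp only [Set.mem_iInter, Set.mem_ofPred_eq, Set.mem_univ, and_true, Set.mem_iUnion,
      Finset.mem_Ico, exists_prop]
    have key : ∀ y : Fin d → ℤ, y ≠ 0 →
        (hitTime R (environment (jumps (fun w => V w o) (fun w => Z w o) (fun w => Y w o)))
          (fun w => Z w o) (z.1 + y) z < (((z.2 : ℝ) + ‖y‖ / R : ℝ) : EReal) ↔
        ∃ s : ℤ, (1 - (coneRadius R y : ℤ) ≤ s ∧ s < coneRadius R y) ∧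
          o ∈ renewalEvent V Z Y (z.1 + y, z.2 + s)) := by
      intro y hy
      have hc : ⌈‖y‖ / R⌉ = (coneRadius R y : ℤ) :=
        (Int.natCast_ceil_eq_ceil (div_nonneg (norm_nonneg y) (Nat.cast_nonneg R))).symm
      rw [hitTime, sInf_lt_iff]
      simp only [Set.exists_mem_image, add_sub_cancel_left, startTime, if_neg hy, hc,
        Set.mem_ofPred_eq, EReal.coe_lt_coe_iff]
      constructor
      · rintro ⟨t, ⟨h1, h2, h3⟩, h4⟩
        refine ⟨t - z.2, ⟨by omega, ?_⟩, ?_⟩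
        · rw [← hc, Int.lt_ceil]; push_cast; linarith
        · rw [add_sub_cancel]; exact ⟨h2, h3⟩
      · rintro ⟨s, ⟨h1, h2⟩, h3, h4⟩
        refine ⟨z.2 + s, ⟨by omega, h3, h4⟩, ?_⟩
        rw [← hc, Int.lt_ceil] at h2
        push_cast; linarith
    constructor
    · intro h y hy
      refine (key y hy).1 ?_
      simpa using h (z.1 + y) (by simpa using hy)
    · intro h x hx
      have hy : x - z.1 ≠ 0 := sub_ne_zero.2 hx
      simpa using (key (x - z.1) hy).2 (h _ hy)

theorem measurableSet_coneEvent {m : MeasurableSpace Ω} {R : ℕ} {E : Site d → Set Ω}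
    {N : Set (Fin d → ℤ)} {z : Site d} (hz : MeasurableSet (E z))
    (h : ∀ y ∈ N, ∀ s ∈ Finset.Ico (1 - (coneRadius R y : ℤ)) (coneRadius R y),
      MeasurableSet (E (z.1 + y, z.2 + s))) :
    MeasurableSet (coneEvent R E N z) :=
  hz.inter <| MeasurableSet.biInter (Set.to_countable _) fun y hy =>
    Finset.measurableSet_biUnion _ fun s hs => h y hy.2 s hs

/-- The event that the window over some far `y` contains no marked point. -/
def farEvent (R : ℕ) (E : Site d → Set Ω) (l : ℕ) (z : Site d) : Set Ω :=
  ⋃ y ∈ {y | l < coneRadius R y},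
    ⋂ s ∈ Finset.Ico (1 - (coneRadius R y : ℤ)) (coneRadius R y), (E (z.1 + y, z.2 + s))ᶜ

theorem mem_coneEvent_univ_iff {R : ℕ} {E : Site d → Set Ω} {l : ℕ} {z : Site d} {o : Ω}
    (ho : o ∉ farEvent R E l z) :
    o ∈ coneEvent R E Set.univ z ↔ o ∈ coneEvent R E {y | coneRadius R y ≤ l} z := by
  simp only [farEvent, Set.mem_iUnion, Set.mem_iInter, Set.mem_compl_iff, Set.mem_ofPred_eq,
    not_exists, not_and, not_forall, not_not, exists_prop] at ho
  simp only [coneEvent, Set.mem_inter_iff, Set.mem_iInter, Set.mem_iUnion, Set.mem_ofPred_eq,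
    Set.mem_univ, and_true, exists_prop]
  refine and_congr_right fun _ => ⟨fun h y hy => h y hy.1, fun h y hy => ?_⟩
  rcases le_or_gt (coneRadius R y) l with hl | hl
  · exact h y ⟨hy, hl⟩
  · exact ho y hl

theorem measure_biInter_compl [MeasurableSpace Ω] {P : Measure Ω} {ι : Type*} {E : ι → Set Ω}
    (hE : ∀ i, MeasurableSet (E i)) (hi : iIndepSet E P) {p : ℝ≥0∞} (hp : ∀ i, P (E i) = p)
    (S : Finset ι) : P (⋂ i ∈ S, (E i)ᶜ) = (1 - p) ^ S.card := by
  have := hi.isProbabilityMeasure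
  rw [((iIndepSet_iff_iIndep _ _).1 hi).meas_biInter fun i _ =>
    (MeasurableSpace.measurableSet_generateFrom (Set.mem_singleton _)).compl]
  simp [prob_compl_eq_one_sub (hE _), hp]

theorem measure_farEvent_le [MeasurableSpace Ω] {P : Measure Ω} {R : ℕ} {E : Site d → Set Ω}
    (hE : ∀ z, MeasurableSet (E z)) (hi : iIndepSet E P) {p : ℝ≥0∞} (hp : ∀ z, P (E z) = p)
    (l : ℕ) (z : Site d) :
    P (farEvent R E l z) ≤ (1 - p) ^ l * ∑' y : Fin d → ℤ, (1 - p) ^ coneRadius R y := by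
  rw [farEvent, ← ENNReal.tsum_mul_left]
  refine (measure_biUnion_le _ (Set.to_countable _) _).trans ?_
  refine le_trans (ENNReal.tsum_le_tsum fun y => ?_) (ENNReal.tsum_comp_le_tsum_of_injective
    Subtype.val_injective fun y => (1 - p) ^ l * (1 - p) ^ coneRadius R y)
  obtain ⟨y, hy⟩ := y
  have hy : l < coneRadius R y := hy
  have hinj : Function.Injective fun s : ℤ => ((z.1 + y, z.2 + s) : Site d) := fun a b hab => by
    simpa using congrArg Prod.snd hab
  have := measure_biInter_compl (fun s => hE _) (hi.precomp hinj) (fun s => hp _)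
    (Finset.Ico (1 - (coneRadius R y : ℤ)) (coneRadius R y))
  refine this.trans_le ?_
  -- For `l < coneRadius R y` the window has at least `l + coneRadius R y` points: `l` of them give
  -- the decay, the others give summability over `y`.
  rw [← pow_add]
  refine pow_le_pow_right_of_le_one' tsub_le_self ?_
  rw [Int.card_Ico]
  dsimp only
  omega

/-- The displacements of radius `m` lie in a cube of side `2 * R * m + 1`, so polynomial growth
meets geometric decay. -/
theorem tsum_pow_coneRadius_ne_top {R : ℕ} (hR : 1 ≤ R) {a : ℝ≥0∞} (ha : a < 1) :
    ∑' y : Fin d → ℤ, a ^ coneRadius R y ≠ ⊤ := by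
  classical
  set box : ℕ → Finset (Fin d → ℤ) := fun m => Finset.Icc (fun _ => -((R * m : ℕ) : ℤ))
    (fun _ => ((R * m : ℕ) : ℤ)) with hbox
  have hmem : ∀ y : Fin d → ℤ, y ∈ box (coneRadius R y) := by
    intro y
    have hRpos : (0 : ℝ) < R := by exact_mod_cast hR
    have h1 : ‖y‖ ≤ (R * coneRadius R y : ℕ) := by
      have := Nat.le_ceil (‖y‖ / R)
      rw [div_le_iff₀ hRpos] at this
      push_cast
      rw [mul_comm]
      exact this
    have h2 : ∀ i, |y i| ≤ (R * coneRadius R y : ℕ) := by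
      intro i
      have := (norm_le_pi_norm y i).trans h1
      rw [Int.norm_eq_abs] at this
      exact_mod_cast this
    rw [hbox, Finset.mem_Icc]
    exact ⟨fun i => (abs_le.1 (h2 i)).1, fun i => (abs_le.1 (h2 i)).2⟩
  have hcard : ∀ m, (box m).card = (2 * R * m + 1) ^ d := by
    intro m
    simp only [hbox, Pi.card_Icc, Int.card_Icc, Finset.prod_const, Finset.card_univ,
      Fintype.card_fin]
    congr 1
    have : 2 * R * m = R * m + R * m := by ring
    omega
  have hle : ∑' y : Fin d → ℤ, a ^ coneRadius R y
      ≤ ∑' m : ℕ, ((2 * R * m + 1) ^ d : ℕ) * a ^ m := by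
    -- Each `y` is counted in every cube that contains it; the overcount is harmless and leaves only
    -- cardinalities of cubes.
    calc ∑' y : Fin d → ℤ, a ^ coneRadius R y
        ≤ ∑' y : Fin d → ℤ, ∑' m : ℕ, if y ∈ box m then a ^ m else 0 := by
          refine ENNReal.tsum_le_tsum fun y => ?_
          refine le_trans ?_ (ENNReal.le_tsum (coneRadius R y))
          rw [if_pos (hmem y)]
      _ = ∑' m : ℕ, ∑' y : Fin d → ℤ, if y ∈ box m then a ^ m else 0 := ENNReal.tsum_comm
      _ = _ := by
          refine tsum_congr fun m => ?_
          rw [tsum_eq_sum (s := box m) fun y hy => if_neg hy,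
            Finset.sum_congr rfl fun y hy => if_pos hy, Finset.sum_const, hcard, nsmul_eq_mul]
  refine ne_top_of_le_ne_top ?_ hle
  have hat : a ≠ ⊤ := (ha.trans ENNReal.one_lt_top).ne
  have ha1 : a.toReal < 1 := by
    simpa using (ENNReal.toReal_lt_toReal hat ENNReal.one_ne_top).2 ha
  have ha0 : 0 ≤ a.toReal := ENNReal.toReal_nonneg
  have hs : Summable fun m : ℕ => ((2 * R * m + 1 : ℝ)) ^ d * a.toReal ^ m := by
    have h1 := (summable_pow_mul_geometric_of_norm_lt_one d
      (show ‖a.toReal‖ < 1 by rwa [Real.norm_of_nonneg ha0])).mul_left (2 ^ (d - 1) * (2 * R : ℝ) ^ d)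
    have h2 := (summable_geometric_of_lt_one ha0 ha1).mul_left ((2 : ℝ) ^ (d - 1))
    refine Summable.of_nonneg_of_le (fun m => by positivity) (fun m => ?_) (h1.add h2)
    calc (2 * R * m + 1 : ℝ) ^ d * a.toReal ^ m
        ≤ (2 ^ (d - 1) * ((2 * R * m : ℝ) ^ d + 1 ^ d)) * a.toReal ^ m := by
          gcongr
          exact add_pow_le (by positivity) zero_le_one d
      _ = _ := by rw [mul_pow (2 * R : ℝ), one_pow]; ring
  have e : ∀ m : ℕ, (((2 * R * m + 1) ^ d : ℕ) : ℝ≥0∞) * a ^ m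
      = ENNReal.ofReal ((2 * R * m + 1 : ℝ) ^ d * a.toReal ^ m) := by
    intro m
    rw [ENNReal.ofReal_mul (by positivity), ENNReal.ofReal_pow ha0, ENNReal.ofReal_toReal hat]
    congr 1
    rw [← ENNReal.ofReal_natCast]
    push_cast
    rfl
  simp_rw [e]
  exact hs.tsum_ofReal_ne_top

theorem Box.finite_sites (A : Box d) : A.sites.Finite := by
  rw [Box.sites, Set.Icc_prod_eq]
  exact (Set.finite_Icc _ _).prod (Set.finite_Icc _ _)

theorem Box.card_sites_le (A : Box d) {r h : ℕ} (hr : A.spatialDiam ≤ r) (hh : A.height ≤ h) :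
    A.finite_sites.toFinset.card ≤ (r + 1) ^ d * (h + 1) := by
  have e : A.finite_sites.toFinset = Finset.Icc A.lo.1 A.hi.1 ×ˢ Finset.Icc A.lo.2 A.hi.2 := by
    ext z
    simp only [Set.Finite.mem_toFinset, Box.sites, Set.mem_Icc, Finset.mem_product,
      Finset.mem_Icc, Prod.le_def]
    tauto
  rw [e, Finset.card_product, Pi.card_Icc, Int.card_Icc]
  refine Nat.mul_le_mul ?_ ?_
  · refine (Finset.prod_le_pow_card _ _ (r + 1) fun i _ => ?_).trans (by simp)
    rw [Int.card_Icc]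
    have h1 : (A.hi.1 i - A.lo.1 i).toNat ≤ r :=
      (Finset.le_sup (f := fun i => (A.hi.1 i - A.lo.1 i).toNat) (Finset.mem_univ i)).trans hr
    omega
  · simp only [Box.height] at hh
    omega

end Field

end RenewalField

namespace RenewalField

/-! ### Decoupling by truncation -/

section Decoupling

variable {d : ℕ} {Ω : Type*}

open Classical in
/-- The indicator field of the cone events. -/
noncomputable def coneField (R : ℕ) (E : Site d → Set Ω) (N : Set (Fin d → ℤ)) (z : Site d)
    (o : Ω) : Fin 2 :=
  if o ∈ coneEvent R E N z then 1 else 0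

theorem eta_eq_coneField [MeasurableSpace Ω] (R : ℕ) (V Z Y : Site d → Ω → ℕ) :
    eta R V Z Y = coneField R (renewalEvent V Z Y) Set.univ := by
  funext z o
  have h := eta_eq_one_iff (R := R) V Z Y z o
  rw [coneField]
  split_ifs with ho
  · exact h.2 ho
  · have : eta R V Z Y z o ≠ 1 := fun h' => ho (h.1 h')
    omega

theorem measurable_coneField {m : MeasurableSpace Ω} {R : ℕ} {E : Site d → Set Ω}
    {N : Set (Fin d → ℤ)} {z : Site d} (hz : MeasurableSet[m] (coneEvent R E N z)) :
    Measurable[m] (coneField R E N z) := by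
  classical
  change Measurable fun o => if o ∈ coneEvent R E N z then (1 : Fin 2) else 0
  exact Measurable.ite hz measurable_const measurable_const

theorem measurable_comp_field {m : MeasurableSpace Ω} {S : Set (Site d)} (hS : S.Finite)
    {X : Site d → Ω → Fin 2} (hX : ∀ z ∈ S, Measurable[m] (X z)) (f : (S → Fin 2) → Fin 2) :
    Measurable[m] fun o => ((f fun z => X z o).val : ℝ) := by
  have := hS.to_subtype
  have h1 : Measurable[m] fun o => fun z : S => X z o :=
    measurable_pi_lambda _ fun z => hX z z.2
  exact (measurable_of_countable fun y : S → Fin 2 => ((f y).val : ℝ)).comp h1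

theorem fin_two_val_mem (a : Fin 2) : (a.val : ℝ) ∈ Set.Icc (0 : ℝ) 1 :=
  ⟨Nat.cast_nonneg _, by exact_mod_cast Nat.le_of_lt_succ a.2⟩

/-- The σ-algebra generated by the events in a time slab around a box. -/
abbrev slabAlg (E : Site d → Set Ω) (l : ℕ) (A : Box d) : MeasurableSpace Ω :=
  ⨆ z ∈ {z : Site d | A.lo.2 - l ≤ z.2 ∧ z.2 ≤ A.hi.2 + l}, MeasurableSpace.generateFrom {E z}

theorem measurableSet_slabAlg {E : Site d → Set Ω} {l : ℕ} {A : Box d} {w : Site d}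
    (hw : A.lo.2 - l ≤ w.2 ∧ w.2 ≤ A.hi.2 + l) : MeasurableSet[slabAlg E l A] (E w) := by
  have hle : MeasurableSpace.generateFrom {E w} ≤ slabAlg E l A :=
    le_iSup₂_of_le (f := fun (z : Site d)
      (_ : z ∈ {z : Site d | A.lo.2 - l ≤ z.2 ∧ z.2 ≤ A.hi.2 + l}) =>
        MeasurableSpace.generateFrom {E z}) w hw le_rfl
  exact hle _ (MeasurableSpace.measurableSet_generateFrom (Set.mem_singleton _))

/-- The local field near a box is measurable with respect to a time slab around the box. -/
theorem measurable_localField {R : ℕ} {E : Site d → Set Ω} (l : ℕ) (A : Box d)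
    (f : (A.sites → Fin 2) → Fin 2) : Measurable[slabAlg E l A]
      fun o => ((f fun z => coneField R E {y | coneRadius R y ≤ l} z o).val : ℝ) := by
  suffices hcone : ∀ z ∈ A.sites, MeasurableSet[slabAlg E l A]
      (coneEvent R E {y | coneRadius R y ≤ l} z) by
    exact @measurable_comp_field d Ω (slabAlg E l A) A.sites A.finite_sites
      (coneField R E {y | coneRadius R y ≤ l}) (fun z hz => measurable_coneField (hcone z hz)) f
  intro z hz
  have h1 : A.lo.2 ≤ z.2 := hz.1.2
  have h2 : z.2 ≤ A.hi.2 := hz.2.2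
  refine @measurableSet_coneEvent d Ω (slabAlg E l A) R E _ z
    (measurableSet_slabAlg ⟨by omega, by omega⟩) fun y hy s hs => measurableSet_slabAlg ?_
  have hy : coneRadius R y ≤ l := hy
  rw [Finset.mem_Ico] at hs
  exact ⟨by dsimp only; omega, by dsimp only; omega⟩

variable [mΩ : MeasurableSpace Ω] {P : Measure Ω}

/-- Approximate independence from exact independence of approximations. -/
theorem integral_mul_le_of_eq_off [IsProbabilityMeasure P] {f f' g g' : Ω → ℝ} {D D' : Set Ω}
    (hf : Measurable f) (hf' : Measurable f') (hg : Measurable g) (hg' : Measurable g')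
    (bf : ∀ o, f o ∈ Set.Icc (0 : ℝ) 1) (bf' : ∀ o, f' o ∈ Set.Icc (0 : ℝ) 1)
    (bg : ∀ o, g o ∈ Set.Icc (0 : ℝ) 1) (bg' : ∀ o, g' o ∈ Set.Icc (0 : ℝ) 1)
    (hD : MeasurableSet D) (hD' : MeasurableSet D')
    (ef : ∀ o ∉ D, f o = f' o) (eg : ∀ o ∉ D', g o = g' o)
    (h : ∫ o, f' o * g' o ∂P = (∫ o, f' o ∂P) * ∫ o, g' o ∂P) :
    ∫ o, f o * g o ∂P ≤ (∫ o, f o ∂P) * (∫ o, g o ∂P) + 2 * (P.real D + P.real D') := by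
  have int : ∀ {k : Ω → ℝ}, Measurable k → (∀ o, k o ∈ Set.Icc (0 : ℝ) 1) → Integrable k P := by
    intro k hk bk
    refine Integrable.of_bound hk.aestronglyMeasurable 1 (Eventually.of_forall fun o => ?_)
    rw [Real.norm_of_nonneg (bk o).1]
    exact (bk o).2
  have mul_mem : ∀ {a b : ℝ}, a ∈ Set.Icc (0 : ℝ) 1 → b ∈ Set.Icc (0 : ℝ) 1 →
      a * b ∈ Set.Icc (0 : ℝ) 1 := fun ha hb =>
    ⟨mul_nonneg ha.1 hb.1, mul_le_one₀ ha.2 hb.1 hb.2⟩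
  have ind : ∀ {S : Set Ω}, MeasurableSet S →
      Integrable (S.indicator fun _ => (1 : ℝ)) P ∧ ∫ o, S.indicator (fun _ => (1 : ℝ)) o ∂P
        = P.real S := fun hS =>
    ⟨(integrable_const 1).indicator hS, by rw [integral_indicator_const _ hS]; simp⟩
  have le_add : ∀ {k k' : Ω → ℝ} {S : Set Ω}, Measurable k → Measurable k' →
      (∀ o, k o ∈ Set.Icc (0 : ℝ) 1) → (∀ o, k' o ∈ Set.Icc (0 : ℝ) 1) → MeasurableSet S →
      (∀ o ∉ S, k o = k' o) → ∫ o, k o ∂P ≤ ∫ o, k' o ∂P + P.real S := by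
    intro k k' S hk hk' bk bk' hS e
    rw [← (ind hS).2, ← integral_add (int hk' bk') (ind hS).1]
    refine integral_mono (int hk bk) ((int hk' bk').add (ind hS).1) fun o => ?_
    by_cases ho : o ∈ S
    · have h1 := (bk o).2
      have h2 := (bk' o).1
      simp only [Set.indicator_of_mem ho]
      linarith
    · simp [ho, e o ho]
  have bnd : ∀ {k : Ω → ℝ}, Measurable k → (∀ o, k o ∈ Set.Icc (0 : ℝ) 1) →
      ∫ o, k o ∂P ∈ Set.Icc (0 : ℝ) 1 := by
    intro k hk bk
    refine ⟨integral_nonneg fun o => (bk o).1, ?_⟩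
    simpa using integral_mono (int hk bk) (integrable_const (1 : ℝ)) fun o => (bk o).2
  have h1 : ∫ o, f o * g o ∂P ≤ ∫ o, f' o * g' o ∂P + P.real (D ∪ D') :=
    le_add (hf.mul hg) (hf'.mul hg') (fun o => mul_mem (bf o) (bg o))
      (fun o => mul_mem (bf' o) (bg' o)) (hD.union hD') fun o ho => by
        rw [ef o fun h => ho (Or.inl h), eg o fun h => ho (Or.inr h)]
  have h2 := le_add hf' hf bf' bf hD fun o ho => (ef o ho).symm
  have h3 := le_add hg' hg bg' bg hD' fun o ho => (eg o ho).symm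
  have h4 := measureReal_union_le (μ := P) D D'
  have h5 := (bnd hg' bg')
  have h6 := (bnd hf bf)
  have h7 : (0 : ℝ) ≤ P.real D := measureReal_nonneg
  have h8 : (0 : ℝ) ≤ P.real D' := measureReal_nonneg
  rw [h] at h1
  -- Passing to the primed product costs `P (D ∪ D')`, and restoring the two factors one at a time
  -- costs `P D` and `P D'`. This gives the factor `2`.
  calc ∫ o, f o * g o ∂P
      ≤ (∫ o, f' o ∂P) * (∫ o, g' o ∂P) + P.real (D ∪ D') := h1
    _ ≤ (∫ o, f o ∂P + P.real D) * (∫ o, g' o ∂P) + P.real (D ∪ D') := by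
        gcongr; exact h5.1
    _ ≤ (∫ o, f o ∂P) * (∫ o, g' o ∂P) + P.real D + P.real (D ∪ D') := by
        rw [add_mul]; gcongr; exact mul_le_of_le_one_right h7 h5.2
    _ ≤ (∫ o, f o ∂P) * (∫ o, g o ∂P + P.real D') + P.real D + P.real (D ∪ D') := by
        gcongr; exact h6.1
    _ ≤ (∫ o, f o ∂P) * (∫ o, g o ∂P) + P.real D' + P.real D + P.real (D ∪ D') := by
        rw [mul_add]; gcongr; exact mul_le_of_le_one_left h8 h6.2
    _ ≤ _ := by linarith

theorem measurableSet_farEvent {R : ℕ} {E : Site d → Set Ω} (hE : ∀ z, MeasurableSet (E z))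
    (l : ℕ) (z : Site d) : MeasurableSet (farEvent R E l z) :=
  MeasurableSet.biUnion (Set.to_countable _) fun _ _ =>
    Finset.measurableSet_biInter _ fun _ _ => (hE _).compl

/-- Decoupling for the cone field of a Bernoulli field of events. -/
theorem coneField_decoupling [IsProbabilityMeasure P] {R : ℕ} {E : Site d → Set Ω}
    (hE : ∀ z, MeasurableSet (E z)) (hi : iIndepSet E P) {p : ℝ≥0∞} (hp : ∀ z, P (E z) = p)
    (htop : ∑' y : Fin d → ℤ, (1 - p) ^ coneRadius R y ≠ ⊤) {r h s : ℕ} (hs : 1 ≤ s) {A B : Box d}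
    (hr : max A.spatialDiam B.spatialDiam ≤ r) (hh : max A.height B.height ≤ h)
    (hsep : (s : ℤ) ≤ A.sep B) (f₁ : (A.sites → Fin 2) → Fin 2) (f₂ : (B.sites → Fin 2) → Fin 2) :
    ∫ o, ((f₁ fun z => coneField R E Set.univ z o).val : ℝ) *
        ((f₂ fun z => coneField R E Set.univ z o).val : ℝ) ∂P ≤
      (∫ o, ((f₁ fun z => coneField R E Set.univ z o).val : ℝ) ∂P) *
        (∫ o, ((f₂ fun z => coneField R E Set.univ z o).val : ℝ) ∂P) +
      4 * (((r + 1) ^ d * (h + 1) : ℕ) * ((1 - p).toReal ^ ((s - 1) / 2) *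
        (∑' y : Fin d → ℤ, (1 - p) ^ coneRadius R y).toReal)) := by
  -- This choice gives `2 * l < s`, so the two boxes enlarged by `l` in time stay disjoint.
  set l := (s - 1) / 2 with hl
  set S := ∑' y : Fin d → ℤ, (1 - p) ^ coneRadius R y with hS
  have hcone : ∀ (N : Set (Fin d → ℤ)) z, Measurable (coneField R E N z) := fun N z =>
    measurable_coneField (measurableSet_coneEvent (hE z) fun _ _ _ _ => hE _)
  set D : Box d → Set Ω := fun A => ⋃ z ∈ A.finite_sites.toFinset, farEvent R E l z with hD
  have hDm : ∀ A, MeasurableSet (D A) := fun A =>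
    Finset.measurableSet_biUnion _ fun z _ => measurableSet_farEvent hE l z
  have hDP : ∀ A : Box d, A.spatialDiam ≤ r → A.height ≤ h →
      P.real (D A) ≤ ((r + 1) ^ d * (h + 1) : ℕ) * ((1 - p).toReal ^ l * S.toReal) := by
    intro A hr hh
    have h1 : P (D A) ≤ ((r + 1) ^ d * (h + 1) : ℕ) * ((1 - p) ^ l * S) := by
      refine (measure_biUnion_finset_le _ _).trans ?_
      refine (Finset.sum_le_card_nsmul _ _ _ fun z _ => measure_farEvent_le hE hi hp l z).trans ?_
      rw [nsmul_eq_mul]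
      gcongr
      exact A.card_sites_le hr hh
    have h2 : ((r + 1) ^ d * (h + 1) : ℕ) * ((1 - p) ^ l * S) ≠ (⊤ : ℝ≥0∞) :=
      ENNReal.mul_ne_top (ENNReal.natCast_ne_top _) (ENNReal.mul_ne_top (ENNReal.pow_ne_top
        (ne_top_of_le_ne_top ENNReal.one_ne_top tsub_le_self)) htop)
    have h3 := ENNReal.toReal_mono h2 h1
    rwa [ENNReal.toReal_mul, ENNReal.toReal_natCast, ENNReal.toReal_mul, ENNReal.toReal_pow] at h3
  have heq : ∀ (A : Box d) (f : (A.sites → Fin 2) → Fin 2), ∀ o ∉ D A,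
      ((f fun z => coneField R E Set.univ z o).val : ℝ) =
        ((f fun z => coneField R E {y | coneRadius R y ≤ l} z o).val : ℝ) := by
    intro A f o ho
    congr 3
    funext z
    have hz : o ∉ farEvent R E l z := fun h' => ho (Set.mem_biUnion (by simp) h')
    classical
    simp only [coneField]
    exact if_congr (mem_coneEvent_univ_iff hz) rfl rfl
  have hdisj : Disjoint {z : Site d | A.lo.2 - l ≤ z.2 ∧ z.2 ≤ A.hi.2 + l}
      {z : Site d | B.lo.2 - l ≤ z.2 ∧ z.2 ≤ B.hi.2 + l} := by
    rw [Set.disjoint_left]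
    rintro z ⟨h1, h2⟩ ⟨h3, h4⟩
    rw [Box.sep] at hsep
    split_ifs at hsep <;> omega
  have hgen : ∀ z, MeasurableSpace.generateFrom {E z} ≤ mΩ := fun z =>
    MeasurableSpace.generateFrom_le (by rintro _ rfl; exact hE z)
  have hind := indep_iSup_of_disjoint hgen ((iIndepSet_iff_iIndep _ _).1 hi) hdisj
  have m1 := measurable_localField (R := R) (E := E) l A f₁
  have m2 := measurable_localField (R := R) (E := E) l B f₂
  have hif : IndepFun (fun o => ((f₁ fun z => coneField R E {y | coneRadius R y ≤ l} z o).val : ℝ))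
      (fun o => ((f₂ fun z => coneField R E {y | coneRadius R y ≤ l} z o).val : ℝ)) P :=
    indep_of_indep_of_le_left (indep_of_indep_of_le_right hind m2.comap_le) m1.comap_le
  have m := fun (A : Box d) (f : (A.sites → Fin 2) → Fin 2) (N : Set (Fin d → ℤ)) =>
    measurable_comp_field A.finite_sites (fun z _ => hcone N z) f
  refine (integral_mul_le_of_eq_off (m A f₁ _) (m A f₁ _) (m B f₂ _) (m B f₂ _)
    (fun o => fin_two_val_mem _) (fun o => fin_two_val_mem _) (fun o => fin_two_val_mem _)
    (fun o => fin_two_val_mem _) (hDm A) (hDm B) (heq A f₁) (heq B f₂) ?_).trans ?_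
  · exact hif.integral_fun_mul_eq_mul_integral (m A f₁ _).aestronglyMeasurable
      (m B f₂ _).aestronglyMeasurable
  · have h1 := hDP A ((le_max_left _ _).trans hr) ((le_max_left _ _).trans hh)
    have h2 := hDP B ((le_max_right _ _).trans hr) ((le_max_right _ _).trans hh)
    linarith

end Decoupling

/-- Geometric decay is faster than any power. -/
theorem exists_geometric_le_rpow {a : ℝ} (ha0 : 0 ≤ a) (ha1 : a < 1) (b : ℝ) :
    ∃ C : ℝ, 0 < C ∧ ∀ s : ℕ, 1 ≤ s → a ^ ((s - 1) / 2) ≤ C * (s : ℝ) ^ b := by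
  -- With this `k`, `s ^ k * s ^ b ≥ 1` for `s ≥ 1`, so it suffices to bound `s ^ k * a ^ ((s - 1) /
  -- 2)`; there `s` is at most `2 * (n + 1)`.
  set k := ⌈-b⌉₊ with hk
  obtain ⟨C, hC⟩ := (tendsto_pow_const_mul_const_pow_of_lt_one k ha0 ha1).bddAbove_range
  have hC : ∀ n : ℕ, (n : ℝ) ^ k * a ^ n ≤ C := fun n => hC ⟨n, rfl⟩
  have hC0 : 0 ≤ C := le_trans (by positivity) (hC 0)
  refine ⟨2 ^ k * (2 ^ (k - 1) * (C + 1)), by positivity, fun s hs => ?_⟩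
  set n := (s - 1) / 2 with hn
  have hs0 : (1 : ℝ) ≤ s := by exact_mod_cast hs
  have hsn : (s : ℝ) ≤ 2 * (n + 1) := by
    have : s ≤ 2 * (n + 1) := by omega
    exact_mod_cast this
  have h1 : (s : ℝ) ^ k * a ^ n ≤ 2 ^ k * (2 ^ (k - 1) * (C + 1)) := by
    calc (s : ℝ) ^ k * a ^ n ≤ (2 * (n + 1)) ^ k * a ^ n := by gcongr
      _ = 2 ^ k * (((n : ℝ) + 1) ^ k * a ^ n) := by rw [mul_pow]; ring
      _ ≤ 2 ^ k * ((2 ^ (k - 1) * ((n : ℝ) ^ k + 1 ^ k)) * a ^ n) := by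
          gcongr
          exact add_pow_le (by positivity) zero_le_one k
      _ = 2 ^ k * (2 ^ (k - 1) * ((n : ℝ) ^ k * a ^ n + a ^ n)) := by rw [one_pow]; ring
      _ ≤ _ := by
          gcongr
          · exact hC n
          · exact pow_le_one₀ ha0 ha1.le
  have h2 : 1 ≤ (s : ℝ) ^ k * (s : ℝ) ^ b := by
    rw [← Real.rpow_natCast, ← Real.rpow_add (by linarith)]
    refine Real.one_le_rpow hs0 ?_
    have := Nat.le_ceil (-b)
    linarith
  calc a ^ n = a ^ n * 1 := (mul_one _).symm
    _ ≤ a ^ n * ((s : ℝ) ^ k * (s : ℝ) ^ b) := by gcongr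
    _ = (s : ℝ) ^ k * a ^ n * (s : ℝ) ^ b := by ring
    _ ≤ _ := by gcongr

end RenewalField

theorem mainTheorem6 (d : ℕ) (hd : 1 ≤ d) (R : ℕ) (hR : 1 ≤ R)
    (μ : PMF ℕ) (hμ : ∀ k : ℕ, μ ≠ PMF.pure k) (hγ : 0 < RenewalField.gammaConst μ)
    (β : ℝ) (hβ : (d : ℝ) + 1 < β) (hmom : RenewalField.moment μ (1 + β) < ⊤)
    (ν : PMF ℕ) (hν : RenewalField.IsResidualLaw μ ν) :
    ∃ c : ℝ, 0 < c ∧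
      ∀ (Ω : Type u) [MeasurableSpace Ω] (P : Measure Ω) [IsProbabilityMeasure P]
        (V Z Y : RenewalField.Site d → Ω → ℕ), RenewalField.IsDriving P μ ν V Z Y →
          RenewalField.IsDecouplingFunction P (RenewalField.eta R V Z Y)
            (fun r h s => c * (r + s) ^ d * h * s ^ ((d : ℝ) - β + 1)) := by
  have hd0 : (0 : ℝ) ≤ d := Nat.cast_nonneg d
  have hM := RenewalField.mean_ne_top (by linarith) hmom
  set p := RenewalField.renewalDensity μ with hp
  have hp0 : 0 < p := RenewalField.renewalDensity_pos hM hγ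
  have ha : 1 - p < 1 := ENNReal.sub_lt_self ENNReal.one_ne_top one_ne_zero hp0.ne'
  have ha1 : (1 - p).toReal < 1 := by
    simpa using (ENNReal.toReal_lt_toReal (ha.trans ENNReal.one_lt_top).ne ENNReal.one_ne_top).2 ha
  have htop := RenewalField.tsum_pow_coneRadius_ne_top (d := d) hR ha
  set S := (∑' y : Fin d → ℤ, (1 - p) ^ RenewalField.coneRadius R y).toReal with hS
  have hS0 : 0 ≤ S := ENNReal.toReal_nonneg
  obtain ⟨C, hC0, hC⟩ := RenewalField.exists_geometric_le_rpow ENNReal.toReal_nonneg ha1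
    ((d : ℝ) - β + 1)
  -- The factor `8` is the `4` of the decoupling bound times the `2` from `t + 1 ≤ 2 * t` for the
  -- height `t`. Using `S + 1` for `S` makes positivity immediate, and `r + 1 ≤ r + s` supplies the
  -- spatial factor.
  refine ⟨8 * C * (S + 1), by positivity, ?_⟩
  intro Ω _ P _ V Z Y h r t s ht hs A B hr hh hsep f₁ f₂
  rw [RenewalField.eta_eq_coneField]
  refine (RenewalField.coneField_decoupling (h.measurableSet_renewalEvent hM hγ hν)
    (h.iIndepSet_renewalEvent hM hγ hν) (h.measure_renewalEvent hM hγ hν) htop hs hr hh hsep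
    f₁ f₂).trans ?_
  refine add_le_add_right ?_ _
  have hs0 : (1 : ℝ) ≤ s := by exact_mod_cast hs
  have ht0 : (1 : ℝ) ≤ t := by exact_mod_cast ht
  push_cast
  calc 4 * (((r : ℝ) + 1) ^ d * (t + 1) * ((1 - p).toReal ^ ((s - 1) / 2) * S))
      ≤ 4 * (((r : ℝ) + s) ^ d * (t + t) * ((C * (s : ℝ) ^ ((d : ℝ) - β + 1)) * (S + 1))) := by
        gcongr
        · exact hC s hs
        · linarith
    _ = _ := by ring
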